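/- Let $d\ge 2$, $\alpha=\frac{2}{d-1}$, and let $\sigma$ be the surface measure on the unit sphere $\mathbb S^{d-1}\subset\mathbb R^d$. Fix a query $q\in\mathbb S^{d-1}$ and a matrix $V\in\mathbb R^{d\times d}$. Let $x_1,x_2,\dots$ be i.i.d. random points of $\mathbb S^{d-1}$ with law $\rho\,d\sigma$, where the density $\rho\ge 0$ is of class $C^2$ on $\mathbb S^{d-1}$ and $\rho(q)>0$. For real numbers $\beta_n$ set $$A_j=\frac{e^{\beta_n\langle q,x_j\rangle}}{\sum_{l=1}^n e^{\beta_n\langle q,x_l\rangle}}\ (1\le j\le n),\qquad \mathrm{ATT}(n)=V\sum_{j=1}^n A_jx_j,\qquad \mathcal Y_n(q)=\mathrm{ATT}(n)-Vq .$$ Let $F(t)=\mathbb P(1-\langle q,x_1\rangle\le t)$. Then the limit $C(q)=\lim_{t\to0^+}F(t)\,t^{-1/\alpha}$ exists and lies in $(0,\infty)$, and, with $a_n=(C(q)n)^\alpha$, the following holds. **Theorem 4.1.** If $\beta_n n^{-\alpha}\to\infty$ as $n\to\infty$, then $$\sqrt{a_n}\,\mathcal Y_n(q)\longrightarrow V\Phi\quad\text{in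 distribution},\qquad \Phi=\sqrt{2R_1}\,\Theta_1,$$ where $R_1$ is a Weibull random variable with $\mathbb P(R_1>r)=e^{-r^{1/\alpha}}$ for all $r\ge0$, and $\Theta_1$ is independent of $R_1$ and uniformly distributed on $\{\theta\in\mathbb R^d:\langle\theta,q\rangle=0,\ \|\theta\|=1\}$, the unit sphere of the tangent space $T_q\mathbb S^{d-1}$. In particular, $\mathcal Y_n(q)\to0$ in probability, and hence $\mathrm{ATT}(n)\to Vq$ in probability. -/

import Mathlib

open MeasureTheory ProbabilityTheory Filter Topology
open scoped Manifold

/-- The unit sphere of `ℝ^d` (Euclidean norm). -/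
abbrev UnitSphere (d : ℕ) : Type :=
  Metric.sphere (0 : EuclideanSpace ℝ (Fin d)) 1

/-- The exponent `α = 2 / (d - 1)`. -/
noncomputable def alphaExp (d : ℕ) : ℝ := 2 / ((d : ℝ) - 1)

/-- Softmax attention weights of the context `x` for the query `q` at inverse temperature `β`. -/
noncomputable def attentionWeight {d n : ℕ} (β : ℝ) (q : UnitSphere d)
    (x : Fin n → UnitSphere d) (j : Fin n) : ℝ :=
  Real.exp (β * inner ℝ (q : EuclideanSpace ℝ (Fin d)) (x j)) /
    ∑ l, Real.exp (β * inner ℝ (q : EuclideanSpace ℝ (Fin d)) (x l))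

/-- The attention output `V ∑ j, A j • x j`. -/
noncomputable def attentionOutput {d n : ℕ} (V : Matrix (Fin d) (Fin d) ℝ) (β : ℝ)
    (q : UnitSphere d) (x : Fin n → UnitSphere d) : EuclideanSpace ℝ (Fin d) :=
  Matrix.toEuclideanCLM (𝕜 := ℝ) V
    (∑ j, attentionWeight β q x j • (x j : EuclideanSpace ℝ (Fin d)))

/-- The displacement: the attention output minus `V q`. -/
noncomputable def attentionDisplacement {d n : ℕ} (V : Matrix (Fin d) (Fin d) ℝ) (β : ℝ)
    (q : UnitSphere d) (x : Fin n → UnitSphere d) : EuclideanSpace ℝ (Fin d) :=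
  attentionOutput V β q x - Matrix.toEuclideanCLM (𝕜 := ℝ) V (q : EuclideanSpace ℝ (Fin d))

/-- Surface measure on the unit sphere of `ℝ^d`. -/
noncomputable def surfaceMeasure (d : ℕ) : Measure (UnitSphere d) :=
  (volume : Measure (EuclideanSpace ℝ (Fin d))).toSphere

/-- The measure with density `ρ` with respect to surface measure. -/
noncomputable def contextLaw {d : ℕ} (ρ : UnitSphere d → ℝ) : Measure (UnitSphere d) :=
  (surfaceMeasure d).withDensity fun x => ENNReal.ofReal (ρ x)

theorem finrank_fact_of_two_le {d : ℕ} (hd : 2 ≤ d) :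
    Fact (Module.finrank ℝ (EuclideanSpace ℝ (Fin d)) = (d - 1) + 1) :=
  ⟨by rw [finrank_euclideanSpace_fin]; omega⟩

/-- `ρ` is of class `C²` on the sphere, regarded as a `(d - 1)`-dimensional manifold. -/
def IsC2OnSphere {d : ℕ} (hd : 2 ≤ d) (ρ : UnitSphere d → ℝ) : Prop :=
  haveI := finrank_fact_of_two_le hd
  ContMDiff (𝓡 (d - 1)) 𝓘(ℝ, ℝ) 2 ρ

/-- The context `X 0, X 1, …` is i.i.d. on the sphere with a `C²` density `ρ` with respect to
surface measure which is positive at the query `q`. -/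
structure IsIIDSphericalContext {d : ℕ} (hd : 2 ≤ d) {Ω : Type*} [MeasurableSpace Ω]
    (P : Measure Ω) (q : UnitSphere d) (ρ : UnitSphere d → ℝ)
    (X : ℕ → Ω → UnitSphere d) : Prop where
  measurable : ∀ i, Measurable (X i)
  indep : iIndepFun X P
  law : ∀ i, P.map (X i) = contextLaw ρ
  density_nonneg : ∀ x, 0 ≤ ρ x
  density_pos : 0 < ρ q
  density_C2 : IsC2OnSphere hd ρ

/-- The distribution function `F(t)` of the distance-to-query `T = 1 - ⟨q, x⟩`, where `x` has
density `ρ`. -/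
noncomputable def d2qCDF {d : ℕ} (q : UnitSphere d) (ρ : UnitSphere d → ℝ) (t : ℝ) : ℝ :=
  (contextLaw ρ).real {x | 1 - inner ℝ (q : EuclideanSpace ℝ (Fin d)) x ≤ t}

/-- The local intensity `C(q) = lim_{t → 0+} F(t) t^{-1/α}`. -/
noncomputable def localIntensity {d : ℕ} (q : UnitSphere d) (ρ : UnitSphere d → ℝ) : ℝ :=
  limUnder (𝓝[>] (0 : ℝ)) fun t => d2qCDF q ρ t * t ^ (-(1 / alphaExp d))

/-- The tangent space at `q` to the unit sphere: the orthogonal complement of `q`. -/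
noncomputable abbrev TangentAt {d : ℕ} (q : UnitSphere d) : Submodule ℝ (EuclideanSpace ℝ (Fin d)) :=
  (Submodule.span ℝ {(q : EuclideanSpace ℝ (Fin d))})ᗮ

/-- The unit sphere of the tangent space at `q`. -/
abbrev TangentSphere {d : ℕ} (q : UnitSphere d) : Type :=
  Metric.sphere (0 : TangentAt q) 1

/-- Surface measure on the tangent unit sphere, obtained from the Lebesgue measure of the Euclidean
space `TangentAt q`. -/
noncomputable def tangentSurface {d : ℕ} (q : UnitSphere d) : Measure (TangentSphere q) :=
  (volume : Measure (TangentAt q)).toSphere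

/-- The uniform probability measure on the tangent unit sphere. -/
noncomputable def tangentUniform {d : ℕ} (q : UnitSphere d) : Measure (TangentSphere q) :=
  (tangentSurface q Set.univ)⁻¹ • tangentSurface q

/-- `R` is a Weibull variable: `P(R > r) = exp(-r^{1/α})` for all `r ≥ 0`. -/
structure IsWeibull {Ω : Type*} [MeasurableSpace Ω] (P : Measure Ω) (α : ℝ) (R : Ω → ℝ) :
    Prop where
  measurable : Measurable R
  tail : ∀ r : ℝ, 0 ≤ r → P.real {ω | r < R ω} = Real.exp (-(r ^ (1 / α)))

/-! Put `D x = 1 - ⟨q, x⟩`, `m = d - 1` and `s n = √(a_n)`, so that `s n ^ m = C(q) * n`. At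
distances of order `1 / s n` from `q` the sphere looks like its tangent space, `D` like half the
squared distance, and the density like a constant. The expected number of sample points within
scaled radius `r` tends to `(r / √2) ^ m`, so the scaled position of the nearest point has limit
density proportional to `exp (-(‖u‖ / √2) ^ m)`. Depth gaps between the closest points are of order
`(s n)⁻²`, whereas `β n / s n ^ 2 → ∞`. Softmax therefore selects the nearest point, whose
displacement carries the limit.

To make this quantitative, take a bounded Lipschitz `f` and a scaled radius `L`. By
`abs_sub_nearest_le`, `f` of the scaled attention shift differs from `f` at the unique nearest point
by at most the sup bound when no sample lies within `L`, plus a sum over ordered pairs of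
`pairWeight`. Taking expectations (`abs_integral_sub_nearest_le`) leaves three quantities depending
only on the law of one point: the nearest-point integral (`tendsto_nearest_term`), the probability
of an empty cap (`tendsto_depth_gt_pow`), and a double integral that vanishes (`tendsto_pair_term`).
Their limits all rest on `tendsto_scaled_integral`, a Laplace-type rescaling in the gnomonic chart,
in which depth depends only on the norm. The empty-cap term disappears on letting `L → ∞` after `n →
∞`.

Polar coordinates (`map_smul_eq_withDensity`) identify the limit density as the law of `√(2R) Θ`;
applying the linear map `V` finishes the proof. -/

open scoped Pointwise

/-! ### Gnomonic coordinates around the query -/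

/-- The depth `1 - cos θ` of the point of the sphere whose gnomonic coordinate has norm
`r = tan θ`. -/
noncomputable def gnomonicDepth (r : ℝ) : ℝ := 1 - (√(1 + r ^ 2))⁻¹

theorem norm_coe_add_tangent {d : ℕ} (q : UnitSphere d) (v : TangentAt q) :
    ‖(q : EuclideanSpace ℝ (Fin d)) + v‖ = √(1 + ‖v‖ ^ 2) := by
  have h : inner ℝ (q : EuclideanSpace ℝ (Fin d)) (v : EuclideanSpace ℝ (Fin d)) = 0 :=
    Submodule.mem_orthogonal_singleton_iff_inner_right.1 v.2
  rw [eq_comm, Real.sqrt_eq_iff_mul_self_eq (by positivity) (norm_nonneg _),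
    norm_add_mul_self_real, h]
  simp [pow_two]

/-- The gnomonic chart: central projection of the affine tangent space at `q` to the sphere. -/
noncomputable def gnomonicChart {d : ℕ} (q : UnitSphere d) (v : TangentAt q) : UnitSphere d :=
  ⟨(√(1 + ‖v‖ ^ 2))⁻¹ • ((q : EuclideanSpace ℝ (Fin d)) + v), by
    have : 0 < √(1 + ‖v‖ ^ 2) := by positivity
    rw [mem_sphere_zero_iff_norm, norm_smul, norm_coe_add_tangent, norm_inv, Real.norm_eq_abs,
      abs_of_pos this, inv_mul_cancel₀ this.ne']⟩

theorem coe_gnomonicChart {d : ℕ} (q : UnitSphere d) (v : TangentAt q) :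
    (gnomonicChart q v : EuclideanSpace ℝ (Fin d)) =
      (√(1 + ‖v‖ ^ 2))⁻¹ • ((q : EuclideanSpace ℝ (Fin d)) + v) := rfl

theorem continuous_gnomonicChart {d : ℕ} (q : UnitSphere d) : Continuous (gnomonicChart q) := by
  refine Continuous.subtype_mk ?_ _
  have h : Continuous fun v : TangentAt q => (√(1 + ‖v‖ ^ 2))⁻¹ :=
    Continuous.inv₀ (by fun_prop) fun v => by positivity
  fun_prop

theorem inner_gnomonicChart {d : ℕ} (q : UnitSphere d) (v : TangentAt q) :
    inner ℝ (q : EuclideanSpace ℝ (Fin d)) (gnomonicChart q v) = (√(1 + ‖v‖ ^ 2))⁻¹ := by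
  have h : inner ℝ (q : EuclideanSpace ℝ (Fin d)) (v : EuclideanSpace ℝ (Fin d)) = 0 :=
    Submodule.mem_orthogonal_singleton_iff_inner_right.1 v.2
  rw [coe_gnomonicChart, inner_smul_right, inner_add_right, h, real_inner_self_eq_norm_sq]
  simp

theorem depth_gnomonicChart {d : ℕ} (q : UnitSphere d) (v : TangentAt q) :
    1 - inner ℝ (q : EuclideanSpace ℝ (Fin d)) (gnomonicChart q v) = gnomonicDepth ‖v‖ := by
  rw [inner_gnomonicChart, gnomonicDepth]

theorem gnomonicChart_zero {d : ℕ} (q : UnitSphere d) : gnomonicChart q 0 = q := by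
  ext1; simp [coe_gnomonicChart]

/-! ### Surface measure through volumes of cones -/

/-- The splitting of `ℝ^d` into the line spanned by `q` and the tangent space at `q`. -/
theorem exists_tangentSplit {d : ℕ} (q : UnitSphere d) :
    ∃ L : (ℝ × TangentAt q) ≃L[ℝ] EuclideanSpace ℝ (Fin d),
      ∀ p, L p = p.1 • (q : EuclideanSpace ℝ (Fin d)) + p.2 := by
  let q' : EuclideanSpace ℝ (Fin d) := q
  have hq : q' ≠ 0 := ne_zero_of_mem_unit_sphere q
  let e₁ : ℝ ≃ₗ[ℝ] (ℝ ∙ q') := LinearEquiv.toSpanNonzeroSingleton ℝ _ q' hq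
  let e₂ := Submodule.prodEquivOfIsCompl (ℝ ∙ q') (ℝ ∙ q')ᗮ
    (Submodule.isCompl_orthogonal (𝕜 := ℝ) (ℝ ∙ q'))
  refine ⟨((e₁.prodCongr (LinearEquiv.refl ℝ _)).trans e₂).toContinuousLinearEquiv, fun p => ?_⟩
  simp [e₁, e₂, q']

theorem finrank_tangentAt {d : ℕ} (hd : 2 ≤ d) (q : UnitSphere d) :
    Module.finrank ℝ (TangentAt q) = d - 1 := by
  have := finrank_fact_of_two_le hd
  exact Submodule.finrank_orthogonal_span_singleton (ne_zero_of_mem_unit_sphere q)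

/-- The cone over a subset of the open hemisphere at `q`, in the coordinates of the splitting. -/
theorem mem_cone_iff {d : ℕ} (q : UnitSphere d) {S : Set (UnitSphere d)}
    (hS : ∀ x ∈ S, 0 < inner ℝ (q : EuclideanSpace ℝ (Fin d)) x) (s : ℝ) (w : TangentAt q) :
    s • (q : EuclideanSpace ℝ (Fin d)) + w ∈ Set.Ioo (0 : ℝ) 1 • ((↑) '' S : Set _) ↔
      0 < s ∧ ∃ v, s • v = w ∧ s * √(1 + ‖v‖ ^ 2) < 1 ∧ gnomonicChart q v ∈ S := by
  constructor
  · rintro ⟨r, ⟨hr0, hr1⟩, _, ⟨x, hx, rfl⟩, h⟩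
    have horth : inner ℝ (q : EuclideanSpace ℝ (Fin d)) (w : EuclideanSpace ℝ (Fin d)) = 0 :=
      Submodule.mem_orthogonal_singleton_iff_inner_right.1 w.2
    have h' : r • (x : EuclideanSpace ℝ (Fin d)) = s • (q : EuclideanSpace ℝ (Fin d)) + w := h
    have hs : s = r * inner ℝ (q : EuclideanSpace ℝ (Fin d)) x := by
      rw [← inner_smul_right, h', inner_add_right, inner_smul_right, horth,
        real_inner_self_eq_norm_sq]
      simp
    have hspos : 0 < s := hs ▸ mul_pos hr0 (hS x hx)
    have hv : s • (s⁻¹ • w) = w := by rw [smul_smul, mul_inv_cancel₀ hspos.ne', one_smul]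
    have heq : r • (x : EuclideanSpace ℝ (Fin d)) =
        s • ((q : EuclideanSpace ℝ (Fin d)) + (s⁻¹ • w : TangentAt q)) := by
      rw [h', smul_add, ← Submodule.coe_smul, hv]
    have hn : r = s * √(1 + ‖s⁻¹ • w‖ ^ 2) := by
      have := congrArg norm heq
      rwa [norm_smul, norm_smul, norm_coe_add_tangent, norm_eq_of_mem_sphere, mul_one,
        Real.norm_eq_abs, Real.norm_eq_abs, abs_of_pos hr0, abs_of_pos hspos] at this
    refine ⟨hspos, s⁻¹ • w, hv, hn ▸ hr1, ?_⟩
    convert hx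
    ext1
    rw [coe_gnomonicChart]
    apply smul_right_injective _ hr0.ne'
    change r • _ = r • _
    rw [heq, smul_smul]
    congr 1
    rw [hn]
    field_simp
  · rintro ⟨hs, v, rfl, h1, hv⟩
    have hp : 0 < √(1 + ‖v‖ ^ 2) := by positivity
    refine ⟨s * √(1 + ‖v‖ ^ 2), ⟨by positivity, h1⟩, _, ⟨_, hv, rfl⟩, ?_⟩
    change (s * √(1 + ‖v‖ ^ 2)) • _ = _
    rw [coe_gnomonicChart, smul_smul, mul_assoc, mul_inv_cancel₀ hp.ne', mul_one, smul_add]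
    rfl

theorem lintegral_Ioo_pow {a : ℝ} (ha : 0 < a) (m : ℕ) :
    ∫⁻ s in Set.Ioo 0 a, ENNReal.ofReal (s ^ m) = ENNReal.ofReal (a ^ (m + 1) / (m + 1)) := by
  rw [Measure.restrict_congr_set Ioo_ae_eq_Ioc,
    ← ofReal_integral_eq_lintegral_ofReal (intervalIntegral.intervalIntegrable_pow _).1,
    ← intervalIntegral.integral_of_le ha.le]
  · simp
  · filter_upwards [ae_restrict_mem measurableSet_Ioc] with y hy
    exact pow_nonneg hy.1.le _

/-- Volume of a cone over a set in gnomonic coordinates. -/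
theorem prod_volume_cone {T : Type*} [NormedAddCommGroup T] [InnerProductSpace ℝ T]
    [FiniteDimensional ℝ T] [MeasurableSpace T] [BorelSpace T] {A : Set T} (hA : MeasurableSet A) :
    ((volume : Measure ℝ).prod (volume : Measure T))
        {p | 0 < p.1 ∧ ∃ v, p.1 • v = p.2 ∧ p.1 * √(1 + ‖v‖ ^ 2) < 1 ∧ v ∈ A} =
      ∫⁻ v in A, ENNReal.ofReal
        ((√(1 + ‖v‖ ^ 2))⁻¹ ^ (Module.finrank ℝ T + 1) / (Module.finrank ℝ T + 1)) := by
  set m := Module.finrank ℝ T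
  have hset : {p : ℝ × T | 0 < p.1 ∧ ∃ v, p.1 • v = p.2 ∧ p.1 * √(1 + ‖v‖ ^ 2) < 1 ∧ v ∈ A} =
      {p : ℝ × T | 0 < p.1 ∧ p.1 * √(1 + ‖p.1⁻¹ • p.2‖ ^ 2) < 1 ∧ p.1⁻¹ • p.2 ∈ A} := by
    ext ⟨s, w⟩
    constructor
    · rintro ⟨hs, v, hw, h⟩
      simp only at hs hw h
      subst hw
      simpa [hs, smul_smul, inv_mul_cancel₀ hs.ne'] using h
    · rintro ⟨hs, h⟩
      simp only at hs h
      exact ⟨hs, s⁻¹ • w, by simp [smul_smul, mul_inv_cancel₀ hs.ne'], h⟩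
  have hm2 : Measurable fun p : ℝ × T => p.1⁻¹ • p.2 := by fun_prop
  have hmeas : MeasurableSet
      {p : ℝ × T | 0 < p.1 ∧ p.1 * √(1 + ‖p.1⁻¹ • p.2‖ ^ 2) < 1 ∧ p.1⁻¹ • p.2 ∈ A} := by
    have h1 : MeasurableSet {p : ℝ × T | 0 < p.1} := measurableSet_lt measurable_const measurable_fst
    have h2 : MeasurableSet {p : ℝ × T | p.1 * √(1 + ‖p.1⁻¹ • p.2‖ ^ 2) < 1} :=
      measurableSet_lt (by fun_prop) measurable_const
    exact h1.inter (h2.inter (hm2 hA))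
  rw [hset, Measure.prod_apply hmeas, ← hset]
  -- The slice at height `s` is the dilate by `s` of a subset of `A`, which gives the factor `s ^
  -- m`. Swapping the integrals then leaves `s` ranging up to `(√(1 + ‖v‖ ^ 2))⁻¹`, whence the
  -- exponent `m + 1`.
  have hslice : ∀ s : ℝ, volume (Prod.mk s ⁻¹' {p : ℝ × T | 0 < p.1 ∧ ∃ v, p.1 • v = p.2 ∧
      p.1 * √(1 + ‖v‖ ^ 2) < 1 ∧ v ∈ A}) = ∫⁻ v in A,
        (Set.Ioo 0 (√(1 + ‖v‖ ^ 2))⁻¹).indicator (fun s => ENNReal.ofReal (s ^ m)) s := by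
    intro s
    by_cases hs : 0 < s
    · have : Prod.mk s ⁻¹' {p : ℝ × T | 0 < p.1 ∧ ∃ v, p.1 • v = p.2 ∧
          p.1 * √(1 + ‖v‖ ^ 2) < 1 ∧ v ∈ A} = s • ({v : T | s * √(1 + ‖v‖ ^ 2) < 1} ∩ A) := by
        ext w
        simp only [Set.mem_preimage, Set.mem_ofPred_eq, Set.mem_smul_set, Set.mem_inter_iff, hs,
          true_and]
        exact ⟨fun ⟨v, a, b⟩ => ⟨v, b, a⟩, fun ⟨v, b, a⟩ => ⟨v, a, b⟩⟩
      have hB : MeasurableSet {v : T | s * √(1 + ‖v‖ ^ 2) < 1} :=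
        measurableSet_lt (by fun_prop) measurable_const
      rw [this, Measure.addHaar_smul, abs_of_pos (by positivity)]
      have heq : ∀ v : T, (Set.Ioo 0 (√(1 + ‖v‖ ^ 2))⁻¹).indicator
          (fun s => ENNReal.ofReal (s ^ m)) s =
          {v : T | s * √(1 + ‖v‖ ^ 2) < 1}.indicator (fun _ => ENNReal.ofReal (s ^ m)) v := by
        intro v
        have : s < (√(1 + ‖v‖ ^ 2))⁻¹ ↔ s * √(1 + ‖v‖ ^ 2) < 1 := by
          rw [lt_inv_comm₀ hs (by positivity), inv_eq_one_div, lt_div_iff₀ hs, mul_comm]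
        by_cases h : s * √(1 + ‖v‖ ^ 2) < 1
        · rw [Set.indicator_of_mem (show s ∈ Set.Ioo _ _ from ⟨hs, this.2 h⟩),
            Set.indicator_of_mem (show v ∈ {v : T | s * √(1 + ‖v‖ ^ 2) < 1} from h)]
        · rw [Set.indicator_of_notMem (fun h' : s ∈ Set.Ioo _ _ => h (this.1 h'.2)),
            Set.indicator_of_notMem (show v ∉ {v : T | s * √(1 + ‖v‖ ^ 2) < 1} from h)]
      simp_rw [heq]
      rw [lintegral_indicator hB, setLIntegral_const, Measure.restrict_apply hB]
    · have h1 : Prod.mk s ⁻¹' {p : ℝ × T | 0 < p.1 ∧ ∃ v, p.1 • v = p.2 ∧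
          p.1 * √(1 + ‖v‖ ^ 2) < 1 ∧ v ∈ A} = ∅ := by
        ext w; simp [hs]
      have h2 : ∀ v : T, (Set.Ioo 0 (√(1 + ‖v‖ ^ 2))⁻¹).indicator
          (fun s => ENNReal.ofReal (s ^ m)) s = 0 := fun v =>
        Set.indicator_of_notMem (fun h' => hs h'.1) _
      simp [h1, h2]
  simp_rw [hslice]
  rw [lintegral_lintegral_swap]
  · refine lintegral_congr fun v => ?_
    rw [lintegral_indicator measurableSet_Ioo, lintegral_Ioo_pow (by positivity)]
  · refine Measurable.aemeasurable ?_
    have : Function.uncurry (fun (s : ℝ) (v : T) => (Set.Ioo 0 (√(1 + ‖v‖ ^ 2))⁻¹).indicator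
        (fun s => ENNReal.ofReal (s ^ m)) s) =
        {p : ℝ × T | 0 < p.1 ∧ p.1 < (√(1 + ‖p.2‖ ^ 2))⁻¹}.indicator
          (fun p => ENNReal.ofReal (p.1 ^ m)) := by
      ext ⟨s, v⟩
      simp [Set.indicator, Function.uncurry]
    rw [this]
    refine Measurable.indicator (by fun_prop) ?_
    exact (measurableSet_lt measurable_const measurable_fst).inter
      (measurableSet_lt measurable_fst (by fun_prop))

/-- Surface measure on the open hemisphere at `q` in gnomonic coordinates, up to a constant. -/
theorem exists_surfaceMeasure_gnomonic {d : ℕ} (hd : 2 ≤ d) (q : UnitSphere d) :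
    ∃ c : ℝ, 0 < c ∧ (surfaceMeasure d).restrict
        {x | 1 - inner ℝ (q : EuclideanSpace ℝ (Fin d)) x < 1} =
      ((volume : Measure (TangentAt q)).withDensity
        fun v => ENNReal.ofReal (c * (√(1 + ‖v‖ ^ 2))⁻¹ ^ d)).map (gnomonicChart q) := by
  obtain ⟨L, hL⟩ := exists_tangentSplit q
  have hm : Module.finrank ℝ (TangentAt q) + 1 = d := by rw [finrank_tangentAt hd]; omega
  have hm' : (Module.finrank ℝ (TangentAt q) : ℝ) + 1 = d := by exact_mod_cast hm
  let μ : Measure (EuclideanSpace ℝ (Fin d)) :=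
    ((volume : Measure ℝ).prod (volume : Measure (TangentAt q))).map L
  have : μ.IsAddHaarMeasure := L.isAddHaarMeasure_map _
  -- Both are Haar measures, so they agree up to a factor. Its value is immaterial: it enters `h 0`
  -- and the intensity alike, and the limit law involves only their ratio.
  set k := Measure.addHaarScalarFactor (volume : Measure (EuclideanSpace ℝ (Fin d))) μ
  have hk : (volume : Measure (EuclideanSpace ℝ (Fin d))) = k • μ :=
    Measure.isAddLeftInvariant_eq_smul _ _
  have hk0 : 0 < k := Measure.addHaarScalarFactor_pos_of_isAddHaarMeasure _ _
  refine ⟨k, hk0, ?_⟩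
  ext S hS
  have hH : MeasurableSet {x : UnitSphere d | 1 - inner ℝ (q : EuclideanSpace ℝ (Fin d)) x < 1} :=
    measurableSet_lt (by fun_prop) measurable_const
  have hpre : MeasurableSet (gnomonicChart q ⁻¹' S) :=
    (continuous_gnomonicChart q).measurable hS
  rw [Measure.restrict_apply hS, Measure.map_apply (continuous_gnomonicChart q).measurable hS,
    withDensity_apply _ hpre, surfaceMeasure, Measure.toSphere_apply' _ (hS.inter hH)]
  have hcone : L ⁻¹' (Set.Ioo (0 : ℝ) 1 • ((↑) '' (S ∩ {x : UnitSphere d |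
      1 - inner ℝ (q : EuclideanSpace ℝ (Fin d)) x < 1}) : Set (EuclideanSpace ℝ (Fin d)))) =
      {p | 0 < p.1 ∧ ∃ v, p.1 • v = p.2 ∧ p.1 * √(1 + ‖v‖ ^ 2) < 1 ∧
        v ∈ gnomonicChart q ⁻¹' S} := by
    ext ⟨s, w⟩
    rw [Set.mem_preimage, hL, mem_cone_iff q (by rintro x ⟨-, hx⟩; simpa using hx)]
    have : ∀ v : TangentAt q, 0 < (√(1 + ‖v‖ ^ 2))⁻¹ := fun v => by positivity
    simp only [Set.mem_inter_iff, Set.mem_ofPred_eq, inner_gnomonicChart, sub_lt_self_iff, this,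
      and_true, Set.mem_preimage]
  conv_lhs => rw [hk]
  have hLm : MeasurableEmbedding L := L.toHomeomorph.measurableEmbedding
  rw [Measure.smul_apply, hLm.map_apply, hcone, prod_volume_cone hpre, finrank_euclideanSpace_fin,
    hm, hm', ENNReal.smul_def, smul_eq_mul, ← mul_assoc,
    ← lintegral_const_mul _ (by fun_prop)]
  refine lintegral_congr fun v => ?_
  rw [← ENNReal.ofReal_natCast, ← ENNReal.ofReal_coe_nnreal, ← ENNReal.ofReal_mul (by positivity),
    ← ENNReal.ofReal_mul (by positivity)]
  congr 1
  have : (d : ℝ) ≠ 0 := by positivity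
  field_simp

/-! ### Depth as a function of the gnomonic radius -/

theorem gnomonicDepth_eq_div (r : ℝ) :
    gnomonicDepth r = r ^ 2 / (√(1 + r ^ 2) * (√(1 + r ^ 2) + 1)) := by
  have hw : 0 < √(1 + r ^ 2) := by positivity
  have hsq : √(1 + r ^ 2) ^ 2 = 1 + r ^ 2 := Real.sq_sqrt (by positivity)
  rw [gnomonicDepth, eq_div_iff (by positivity)]
  field_simp
  nlinarith

theorem gnomonicDepth_le (r : ℝ) : gnomonicDepth r ≤ r ^ 2 / 2 := by
  have hw : 1 ≤ √(1 + r ^ 2) := Real.one_le_sqrt.2 (by nlinarith)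
  rw [gnomonicDepth_eq_div]
  gcongr
  nlinarith

/-- Together with `gnomonicDepth_le` this makes depth comparable to the squared radius near `q`; the
lower bound supplies the Gaussian domination in `tendsto_scaled_integral`. -/
theorem le_gnomonicDepth {r : ℝ} (hr : |r| ≤ 1) : r ^ 2 / 4 ≤ gnomonicDepth r := by
  have hr2 : r ^ 2 ≤ 1 := by rw [← sq_abs]; nlinarith [abs_nonneg r]
  have hw : √(1 + r ^ 2) ≤ 3 / 2 := Real.sqrt_le_iff.2 ⟨by norm_num, by linarith⟩
  have hw' : √(1 + r ^ 2) * (√(1 + r ^ 2) + 1) ≤ 4 := by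
    have hsq : √(1 + r ^ 2) ^ 2 = 1 + r ^ 2 := Real.sq_sqrt (by positivity)
    nlinarith
  rw [gnomonicDepth_eq_div]
  have hw : 0 < √(1 + r ^ 2) := by positivity
  gcongr

theorem abs_le_one_of_gnomonicDepth_le {r : ℝ} (hr : gnomonicDepth r ≤ 1 / 4) : |r| ≤ 1 := by
  have hw : 0 < √(1 + r ^ 2) := by positivity
  have hsq : √(1 + r ^ 2) ^ 2 = 1 + r ^ 2 := Real.sq_sqrt (by positivity)
  rw [gnomonicDepth, sub_le_comm, le_inv_comm₀ (by norm_num) hw] at hr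
  rw [← sq_le_one_iff_abs_le_one]
  nlinarith

theorem gnomonicDepth_lt_iff {r r' : ℝ} (hr : 0 ≤ r) (hr' : 0 ≤ r') :
    gnomonicDepth r < gnomonicDepth r' ↔ r < r' := by
  have hw : 0 < √(1 + r ^ 2) := by positivity
  have hw' : 0 < √(1 + r' ^ 2) := by positivity
  rw [gnomonicDepth, gnomonicDepth, sub_lt_sub_iff_left, inv_lt_inv₀ hw' hw,
    Real.sqrt_lt_sqrt_iff (by positivity), add_lt_add_iff_left, pow_lt_pow_iff_left₀ hr hr' two_ne_zero]

theorem gnomonicDepth_le_iff {r r' : ℝ} (hr : 0 ≤ r) (hr' : 0 ≤ r') :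
    gnomonicDepth r ≤ gnomonicDepth r' ↔ r ≤ r' := by
  rw [← not_lt, gnomonicDepth_lt_iff hr' hr, not_lt]

theorem continuous_gnomonicDepth : Continuous gnomonicDepth :=
  continuous_const.sub (Continuous.inv₀ (by fun_prop) fun r => by positivity)

theorem gnomonicDepth_zero : gnomonicDepth 0 = 0 := by simp [gnomonicDepth]

/-- Every depth in `[0, 1)` is attained. -/
theorem gnomonicDepth_sqrt {t : ℝ} (h0 : 0 ≤ t) (h1 : t < 1) :
    gnomonicDepth (√(t * (2 - t)) / (1 - t)) = t := by
  have h : 0 < 1 - t := by linarith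
  have : 1 + (√(t * (2 - t)) / (1 - t)) ^ 2 = ((1 - t)⁻¹) ^ 2 := by
    rw [div_pow, Real.sq_sqrt (by nlinarith)]
    field_simp
    ring
  rw [gnomonicDepth, this, Real.sqrt_sq (by positivity), inv_inv]
  ring

/-- Depth is half the squared radius to leading order; this is the source of the factor `√2` in the
limit law. -/
theorem tendsto_sq_mul_gnomonicDepth {ι : Type*} {l : Filter ι} {s : ι → ℝ}
    (hs : Tendsto s l atTop) (r : ℝ) :
    Tendsto (fun i => s i ^ 2 * gnomonicDepth ((s i)⁻¹ * r)) l (𝓝 (r ^ 2 / 2)) := by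
  have h1 : Tendsto (fun i => √(1 + ((s i)⁻¹ * r) ^ 2)) l (𝓝 1) := by
    have : Tendsto (fun i => √(1 + ((s i)⁻¹ * r) ^ 2)) l (𝓝 (√(1 + (0 * r) ^ 2))) :=
      (((hs.inv_tendsto_atTop.mul_const r).pow 2).const_add 1).sqrt
    simpa using this
  have h2 : Tendsto (fun i => r ^ 2 / (√(1 + ((s i)⁻¹ * r) ^ 2) * (√(1 + ((s i)⁻¹ * r) ^ 2) + 1)))
      l (𝓝 (r ^ 2 / (1 * (1 + 1)))) :=
    tendsto_const_nhds.div (h1.mul (h1.add_const 1)) (by norm_num)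
  norm_num at h2
  refine h2.congr' ?_
  filter_upwards [hs.eventually_gt_atTop 0] with i hi
  rw [gnomonicDepth_eq_div]
  have hw : 0 < √(1 + ((s i)⁻¹ * r) ^ 2) := by positivity
  field_simp

/-! ### Rescaled integrals near the query -/

/-- A measure `μ` with depth function `D` which, where `D < 1`, is the image under the chart `γ`
of a measure with continuous density `h`, the depth of `γ v` being `gnomonicDepth ‖v‖`. -/
structure IsGnomonicModel {S T : Type*} [MeasurableSpace S] [NormedAddCommGroup T]
    [InnerProductSpace ℝ T] [FiniteDimensional ℝ T] [MeasurableSpace T] [BorelSpace T]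
    (μ : Measure S) (D : S → ℝ) (γ : T → S) (h : T → ℝ) : Prop where
  measurable_depth : Measurable D
  depth_nonneg : ∀ x, 0 ≤ D x
  measurable_chart : Measurable γ
  depth_chart : ∀ v, D (γ v) = gnomonicDepth ‖v‖
  continuous_density : Continuous h
  density_nonneg : ∀ v, 0 ≤ h v
  restrict_eq : μ.restrict {x | D x < 1} = (volume.withDensity fun v => ENNReal.ofReal (h v)).map γ

namespace IsGnomonicModel

variable {S T : Type*} [MeasurableSpace S] [NormedAddCommGroup T] [InnerProductSpace ℝ T]
  [FiniteDimensional ℝ T] [MeasurableSpace T] [BorelSpace T] {μ : Measure S} {D : S → ℝ}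
  {γ : T → S} {h : T → ℝ}

/-- Since `a < 1`, the cap lies in the hemisphere that the chart covers. -/
theorem setIntegral_eq (H : IsGnomonicModel μ D γ h) {a : ℝ} (ha : a < 1) {Φ : S → ℝ}
    (hΦ : Measurable Φ) :
    ∫ x in {x | D x ≤ a}, Φ x ∂μ =
      ∫ v, {v | gnomonicDepth ‖v‖ ≤ a}.indicator (fun v => Φ (γ v) * h v) v := by
  have hA : MeasurableSet {x | D x ≤ a} := measurableSet_le H.measurable_depth measurable_const
  have hsub : {x | D x ≤ a} ∩ {x | D x < 1} = {x | D x ≤ a} :=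
    Set.inter_eq_left.2 fun x (hx : D x ≤ a) => lt_of_le_of_lt hx ha
  calc ∫ x in {x | D x ≤ a}, Φ x ∂μ
      = ∫ x in {x | D x ≤ a}, Φ x ∂(μ.restrict {x | D x < 1}) := by
        rw [Measure.restrict_restrict hA, hsub]
    _ = ∫ x, {x | D x ≤ a}.indicator Φ x ∂(μ.restrict {x | D x < 1}) :=
        (integral_indicator hA).symm
    _ = ∫ v, {x | D x ≤ a}.indicator Φ (γ v)
          ∂(volume.withDensity fun v => ENNReal.ofReal (h v)) := by
        rw [H.restrict_eq, integral_map H.measurable_chart.aemeasurable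
          (hΦ.indicator hA).aestronglyMeasurable]
    _ = ∫ v, h v * {x | D x ≤ a}.indicator Φ (γ v) := by
        rw [integral_withDensity_eq_integral_toReal_smul
          H.continuous_density.measurable.ennreal_ofReal (by simp)]
        simp [H.density_nonneg]
    _ = _ := by
        congr with v
        by_cases hv : gnomonicDepth ‖v‖ ≤ a
        · simp [hv, H.depth_chart, mul_comm]
        · simp [hv, H.depth_chart]

/-- Substituting `v = u / s` on the cap `D ≤ 1/4` produces the factor `s ^ m`, and dominated
convergence applies because `s ^ 2 * D / 2 ≥ ‖u‖ ^ 2 / 8` there. Off the cap the integrand is at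
most `c * exp (-s ^ 2 / 8)`, which beats `s ^ m`. -/
theorem tendsto_scaled_integral [IsProbabilityMeasure μ] (H : IsGnomonicModel μ D γ h)
    {ι : Type*} {l : Filter ι} [l.IsCountablyGenerated] {s : ι → ℝ} (hs : Tendsto s l atTop)
    {Φ : ι → S → ℝ} {c : ℝ} (hc : 0 ≤ c) (hm : ∀ᶠ i in l, Measurable (Φ i))
    (hb : ∀ᶠ i in l, ∀ x, |Φ i x| ≤ c * Real.exp (-(s i ^ 2 * D x / 2))) {φ : T → ℝ}
    (hlim : ∀ᵐ u : T, Tendsto (fun i => Φ i (γ ((s i)⁻¹ • u))) l (𝓝 (φ u))) :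
    Tendsto (fun i => s i ^ Module.finrank ℝ T * ∫ x, Φ i x ∂μ) l (𝓝 (h 0 * ∫ u, φ u)) := by
  set m := Module.finrank ℝ T
  -- Depth at most `1/4` forces `‖v‖ ≤ 1`, where `h` is bounded and `le_gnomonicDepth` holds.
  have hA : MeasurableSet {x | D x ≤ 1 / 4} := measurableSet_le H.measurable_depth measurable_const
  obtain ⟨B, hB⟩ := (isCompact_closedBall (0 : T) 1).bddAbove_image H.continuous_density.continuousOn
  have hB' : ∀ v : T, ‖v‖ ≤ 1 → h v ≤ B := fun v hv =>
    hB ⟨v, by simpa using hv, rfl⟩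
  have hB0 : 0 ≤ B := (H.density_nonneg 0).trans (hB' 0 (by simp))
  let G : ι → T → ℝ := fun i v =>
    {v | gnomonicDepth ‖v‖ ≤ 1 / 4}.indicator (fun v => Φ i (γ v) * h v) v
  have hnear : Tendsto (fun i => ∫ u, G i ((s i)⁻¹ • u)) l (𝓝 (∫ u, h 0 * φ u)) := by
    refine tendsto_integral_filter_of_dominated_convergence
      (fun u => B * c * Real.exp (-(1 / 8) * ‖u‖ ^ 2)) ?_ ?_ ?_ ?_
    · filter_upwards [hm] with i hi
      refine Measurable.aestronglyMeasurable ?_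
      have : Measurable (G i) :=
        ((hi.comp H.measurable_chart).mul H.continuous_density.measurable).indicator
          (measurableSet_le (continuous_gnomonicDepth.measurable.comp measurable_norm)
            measurable_const)
      exact this.comp (measurable_const_smul _)
    · filter_upwards [hb, hs.eventually_gt_atTop 0] with i hi hsi
      refine ae_of_all _ fun u => ?_
      by_cases hu : gnomonicDepth ‖(s i)⁻¹ • u‖ ≤ 1 / 4
      · have h1 := abs_le_one_of_gnomonicDepth_le hu
        have h2 := le_gnomonicDepth h1
        rw [abs_norm] at h1
        have h3 : ‖u‖ ^ 2 / 4 ≤ s i ^ 2 * gnomonicDepth ‖(s i)⁻¹ • u‖ := by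
          calc ‖u‖ ^ 2 / 4 = s i ^ 2 * (‖(s i)⁻¹ • u‖ ^ 2 / 4) := by
                rw [norm_smul, norm_inv, Real.norm_eq_abs, abs_of_pos hsi]
                field_simp
            _ ≤ _ := by gcongr
        simp only [G]
        rw [Set.indicator_of_mem (by exact hu), norm_mul, Real.norm_eq_abs, Real.norm_eq_abs,
          abs_of_nonneg (H.density_nonneg _)]
        calc |Φ i (γ ((s i)⁻¹ • u))| * h ((s i)⁻¹ • u)
            ≤ (c * Real.exp (-(1 / 8) * ‖u‖ ^ 2)) * B := by
              refine mul_le_mul ((hi _).trans ?_) (hB' _ h1) (H.density_nonneg _) (by positivity)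
              rw [H.depth_chart]
              gcongr
              linarith
          _ = _ := by ring
      · simp only [G]
        rw [Set.indicator_of_notMem (by exact hu), norm_zero]
        positivity
    · have := (GaussianFourier.integrable_cexp_neg_mul_sq_norm_add (b := (1 / 8 : ℂ)) (V := T)
        (by norm_num) 0 0).norm
      refine (this.const_mul (B * c)).congr (ae_of_all _ fun u => ?_)
      simp only [Complex.norm_exp]
      congr 2
      simp [← Complex.ofReal_pow]
    · filter_upwards [hlim] with u hu
      have h0 : Tendsto (fun i => (s i)⁻¹ • u) l (𝓝 0) := by
        simpa using hs.inv_tendsto_atTop.smul_const u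
      have h1 : Tendsto (fun i => h ((s i)⁻¹ • u)) l (𝓝 (h 0)) :=
        (H.continuous_density.tendsto 0).comp h0
      have h2 : Tendsto (fun i => gnomonicDepth ‖(s i)⁻¹ • u‖) l (𝓝 0) := by
        simpa [gnomonicDepth_zero, Function.comp_def] using
          (continuous_gnomonicDepth.tendsto _).comp h0.norm
      rw [mul_comm]
      refine (hu.mul h1).congr' ?_
      filter_upwards [h2.eventually_le_const (u := 1 / 4) (by norm_num)] with i hi
      simp only [G]
      rw [Set.indicator_of_mem (by exact hi)]
  have hfar : Tendsto (fun i => s i ^ m * ∫ x in {x | D x ≤ 1 / 4}ᶜ, Φ i x ∂μ) l (𝓝 0) := by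
    have h1 : Tendsto (fun i => s i ^ m * (c * Real.exp (-(s i ^ 2 / 8)))) l (𝓝 0) := by
      have h2 : Tendsto (fun x : ℝ => c * 8 ^ m * (x ^ m * Real.exp (-x))) atTop (𝓝 0) := by
        simpa using (Real.tendsto_pow_mul_exp_neg_atTop_nhds_zero m).const_mul (c * 8 ^ m)
      have h3 : Tendsto (fun i => s i ^ 2 / 8) l atTop :=
        ((tendsto_pow_atTop two_ne_zero).comp hs).atTop_div_const (by norm_num)
      refine squeeze_zero' ?_ ?_ (h2.comp h3)
      · filter_upwards [hs.eventually_ge_atTop 0] with i hi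
        positivity
      · filter_upwards [hs.eventually_ge_atTop 1] with i hi
        have : s i ^ m ≤ (s i ^ 2) ^ m := by
          gcongr
          nlinarith
        calc s i ^ m * (c * Real.exp (-(s i ^ 2 / 8)))
            ≤ (s i ^ 2) ^ m * (c * Real.exp (-(s i ^ 2 / 8))) := by gcongr
          _ = _ := by
            simp only [Function.comp, div_pow]
            field_simp
    refine squeeze_zero_norm' ?_ h1
    filter_upwards [hb, hs.eventually_ge_atTop 0] with i hi hsi
    rw [norm_mul, norm_pow, Real.norm_eq_abs, abs_of_nonneg hsi]
    gcongr
    calc ‖∫ x in {x | D x ≤ 1 / 4}ᶜ, Φ i x ∂μ‖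
        ≤ (c * Real.exp (-(s i ^ 2 / 8))) * μ.real {x | D x ≤ 1 / 4}ᶜ := by
          refine norm_setIntegral_le_of_norm_le_const (measure_lt_top _ _) fun x hx => ?_
          refine (hi x).trans ?_
          have : 1 / 4 < D x := by simpa using hx
          refine mul_le_mul_of_nonneg_left (Real.exp_le_exp.2 ?_) hc
          nlinarith [sq_nonneg (s i)]
      _ ≤ (c * Real.exp (-(s i ^ 2 / 8))) * 1 := by
          gcongr
          exact measureReal_le_one
      _ = _ := mul_one _
  have hsum := hnear.add hfar
  rw [integral_const_mul, add_zero] at hsum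
  refine hsum.congr' ?_
  filter_upwards [hb, hm, hs.eventually_gt_atTop 0] with i hi hmi hsi
  have hint : Integrable (Φ i) μ := by
    refine Integrable.of_bound hmi.aestronglyMeasurable c (ae_of_all _ fun x => (hi x).trans ?_)
    refine mul_le_of_le_one_right hc (Real.exp_le_one_iff.2 ?_)
    have := H.depth_nonneg x
    simp only [Left.neg_nonpos_iff]
    positivity
  rw [← integral_add_compl hA hint, mul_add, H.setIntegral_eq (by norm_num) hmi,
    Measure.integral_comp_smul]
  congr 2
  rw [inv_pow, inv_inv, abs_of_pos (by positivity)]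

end IsGnomonicModel

namespace IsGnomonicModel

variable {S T : Type*} [MeasurableSpace S] [NormedAddCommGroup T] [InnerProductSpace ℝ T]
  [FiniteDimensional ℝ T] [MeasurableSpace T] [BorelSpace T] {μ : Measure S} {D : S → ℝ}
  {γ : T → S} {h : T → ℝ}

theorem depth_chart_smul (H : IsGnomonicModel μ D γ h) {s : ℝ} (hs : 0 < s) (u : T) :
    D (γ (s⁻¹ • u)) = gnomonicDepth (s⁻¹ * ‖u‖) := by
  rw [H.depth_chart, norm_smul, norm_inv, Real.norm_eq_abs, abs_of_pos hs]

/-- Weighting by `exp (-s² D / 2)` costs at most a constant on a cap of scaled radius `L`. -/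
theorem one_le_exp_of_depth_le {s L δ : ℝ} (hs : 0 < s) (hδ : δ ≤ gnomonicDepth (s⁻¹ * L)) :
    1 ≤ Real.exp (L ^ 2 / 4) * Real.exp (-(s ^ 2 * δ / 2)) := by
  rw [← Real.exp_add, Real.one_le_exp_iff]
  have h2 : δ ≤ (s⁻¹ * L) ^ 2 / 2 := hδ.trans (gnomonicDepth_le _)
  have : s ^ 2 * δ ≤ s ^ 2 * ((s⁻¹ * L) ^ 2 / 2) := by gcongr
  have h3 : s ^ 2 * ((s⁻¹ * L) ^ 2 / 2) = L ^ 2 / 2 := by field_simp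
  linarith

/-- The normalised mass of shrinking caps. -/
theorem tendsto_scaled_cdf [IsProbabilityMeasure μ] (H : IsGnomonicModel μ D γ h)
    {ι : Type*} {l : Filter ι} [l.IsCountablyGenerated] {s : ι → ℝ} (hs : Tendsto s l atTop)
    {r : ℝ} (hr : 0 ≤ r) :
    Tendsto (fun i => s i ^ Module.finrank ℝ T * μ.real {x | D x ≤ gnomonicDepth ((s i)⁻¹ * r)}) l
      (𝓝 (h 0 * (r ^ Module.finrank ℝ T * volume.real (Metric.ball (0 : T) 1)))) := by
  have hA : ∀ a, MeasurableSet {x | D x ≤ a} := fun a =>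
    measurableSet_le H.measurable_depth measurable_const
  have := H.tendsto_scaled_integral hs (c := Real.exp (r ^ 2 / 4)) (by positivity)
    (Φ := fun i => {x | D x ≤ gnomonicDepth ((s i)⁻¹ * r)}.indicator 1)
    (.of_forall fun i => measurable_one.indicator (hA _)) ?_
    (φ := (Metric.closedBall (0 : T) r).indicator 1) ?_
  · rw [integral_indicator_one Metric.isClosed_closedBall.measurableSet,
      Measure.addHaar_real_closedBall _ _ hr] at this
    simpa only [integral_indicator_one (hA _)] using this
  · filter_upwards [hs.eventually_gt_atTop 0] with i hi x
    by_cases hx : D x ≤ gnomonicDepth ((s i)⁻¹ * r)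
    · rw [Set.indicator_of_mem (by exact hx), Pi.one_apply, abs_one]
      exact one_le_exp_of_depth_le hi hx
    · rw [Set.indicator_of_notMem (by exact hx), abs_zero]
      positivity
  · refine ae_of_all _ fun u => tendsto_const_nhds.congr' ?_
    filter_upwards [hs.eventually_gt_atTop 0] with i hi
    have : D (γ ((s i)⁻¹ • u)) ≤ gnomonicDepth ((s i)⁻¹ * r) ↔ ‖u‖ ≤ r := by
      rw [H.depth_chart_smul hi, gnomonicDepth_le_iff (by positivity) (by positivity),
        mul_le_mul_iff_right₀ (by positivity)]
    simp [Set.indicator, this]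

/-! ### Local intensity and the nearest point -/

/-- The local intensity of the depth. -/
theorem tendsto_cdf_mul_rpow [IsProbabilityMeasure μ] (H : IsGnomonicModel μ D γ h) :
    Tendsto (fun t : ℝ => μ.real {x | D x ≤ t} * t ^ (-((Module.finrank ℝ T : ℝ) / 2))) (𝓝[>] 0)
      (𝓝 (h 0 * volume.real (Metric.ball (0 : T) 1) * √2 ^ Module.finrank ℝ T)) := by
  set m := Module.finrank ℝ T
  have hev : ∀ᶠ t : ℝ in 𝓝[>] 0, t ∈ Set.Ioo (0 : ℝ) 1 := Ioo_mem_nhdsGT one_pos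
  -- This is the gnomonic radius `r` whose depth is exactly `t`. The cap estimate is used at scale
  -- `s = r⁻¹` and radius `1`; the correction `(r / √t) ^ m` tends to `√2 ^ m`.
  have hr : Tendsto (fun t : ℝ => √(t * (2 - t)) / (1 - t)) (𝓝[>] 0) (𝓝[>] 0) := by
    refine tendsto_nhdsWithin_iff.2 ⟨?_, ?_⟩
    · have : ContinuousAt (fun t : ℝ => √(t * (2 - t)) / (1 - t)) 0 :=
        ContinuousAt.div (by fun_prop) (by fun_prop) (by norm_num)
      have h2 := this.tendsto
      simp only [zero_mul, Real.sqrt_zero, zero_div] at h2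
      exact h2.mono_left nhdsWithin_le_nhds
    · filter_upwards [hev] with t ht
      have h1 : 0 < 1 - t := by linarith [ht.2]
      have h2 : 0 < t * (2 - t) := mul_pos ht.1 (by linarith)
      exact div_pos (Real.sqrt_pos.2 h2) h1
  have h1 := H.tendsto_scaled_cdf hr.inv_tendsto_nhdsGT_zero zero_le_one
  have h2 : Tendsto (fun t : ℝ => (√(2 - t) / (1 - t)) ^ m) (𝓝[>] 0) (𝓝 (√2 ^ m)) := by
    have : ContinuousAt (fun t : ℝ => (√(2 - t) / (1 - t)) ^ m) 0 :=
      (ContinuousAt.div (by fun_prop) (by fun_prop) (by norm_num)).pow m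
    have h2 := this.tendsto
    simp only [sub_zero, div_one] at h2
    exact h2.mono_left nhdsWithin_le_nhds
  have h3 := h1.mul h2
  rw [one_pow, one_mul] at h3
  refine h3.congr' ?_
  filter_upwards [hev] with t ht
  have ht1 : 0 < 1 - t := by linarith [ht.2]
  have ht0 : 0 < √t := Real.sqrt_pos.2 ht.1
  have ht2 : 0 < √(2 - t) := Real.sqrt_pos.2 (by linarith)
  simp only [Pi.inv_apply, inv_inv, mul_one, gnomonicDepth_sqrt ht.1.le ht.2]
  have hrt : t ^ (-((m : ℝ) / 2)) = (√t ^ m)⁻¹ := by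
    rw [Real.rpow_neg ht.1.le, Real.sqrt_eq_rpow, ← Real.rpow_natCast, ← Real.rpow_mul ht.1.le]
    ring_nf
  change ((√(t * (2 - t)) / (1 - t))⁻¹) ^ m * _ * _ = _
  rw [hrt, Real.sqrt_mul ht.1.le, inv_pow, div_pow, div_pow, mul_pow]
  field_simp

/-- The local intensity of a model. -/
noncomputable def intensity (h : T → ℝ) : ℝ :=
  h 0 * volume.real (Metric.ball (0 : T) 1) * √2 ^ Module.finrank ℝ T

theorem intensity_pos (h0 : 0 < h 0) : 0 < intensity h := by
  have : 0 < volume.real (Metric.ball (0 : T) 1) :=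
    ENNReal.toReal_pos (Metric.measure_ball_pos _ _ one_pos).ne' measure_ball_lt_top.ne
  rw [intensity]; positivity

section Sequence

variable [IsProbabilityMeasure μ] {s : ℕ → ℝ}

/-- The left side is the expected number of sample points in the cap. The normalisation `s n ^ m =
intensity h * n` cancels `h 0` and the volume of the ball, leaving only `√2`. -/
theorem tendsto_nat_mul_cdf (H : IsGnomonicModel μ D γ h) (h0 : 0 < h 0)
    (hs : Tendsto s atTop atTop) (hsn : ∀ n : ℕ, s n ^ Module.finrank ℝ T = intensity h * n)
    {r : ℝ} (hr : 0 ≤ r) :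
    Tendsto (fun n : ℕ => n * μ.real {x | D x ≤ gnomonicDepth ((s n)⁻¹ * r)}) atTop
      (𝓝 ((r / √2) ^ Module.finrank ℝ T)) := by
  have hC := intensity_pos h0
  have h1 := (H.tendsto_scaled_cdf hs hr).const_mul (intensity h)⁻¹
  have hω : 0 < volume.real (Metric.ball (0 : T) 1) :=
    ENNReal.toReal_pos (Metric.measure_ball_pos _ _ one_pos).ne' measure_ball_lt_top.ne
  have h2 : (intensity h)⁻¹ * (h 0 * (r ^ Module.finrank ℝ T * volume.real (Metric.ball (0 : T) 1)))
      = (r / √2) ^ Module.finrank ℝ T := by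
    rw [intensity, div_pow]
    field_simp
  rw [h2] at h1
  refine h1.congr fun n => ?_
  rw [hsn, mul_assoc, inv_mul_cancel_left₀ hC.ne']

theorem measureReal_depth_gt (H : IsGnomonicModel μ D γ h) (a : ℝ) :
    μ.real {y | a < D y} = 1 - μ.real {y | D y ≤ a} := by
  have : {y | a < D y} = {y | D y ≤ a}ᶜ := by ext; simp
  rw [this, probReal_compl_eq_one_sub (measurableSet_le H.measurable_depth measurable_const)]

/-- This is the Poisson limit `(1 - p n) ^ n → exp (-c)` when `n * p n → c`. -/
theorem tendsto_depth_gt_pow (H : IsGnomonicModel μ D γ h) (h0 : 0 < h 0)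
    (hs : Tendsto s atTop atTop) (hsn : ∀ n : ℕ, s n ^ Module.finrank ℝ T = intensity h * n)
    {r : ℝ} (hr : 0 ≤ r) :
    Tendsto (fun n : ℕ => μ.real {x | gnomonicDepth ((s n)⁻¹ * r) < D x} ^ n) atTop
      (𝓝 (Real.exp (-(r / √2) ^ Module.finrank ℝ T))) := by
  have := (H.tendsto_nat_mul_cdf h0 hs hsn hr).neg
  simp_rw [← mul_neg] at this
  simpa only [H.measureReal_depth_gt, sub_eq_add_neg] using
    Real.tendsto_one_add_pow_exp_of_tendsto this

/-- One factor may be dropped because it tends to `1`. The exponent `n - 1` counts the points other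
than the nearest one. -/
theorem tendsto_depth_gt_pow_sub_one (H : IsGnomonicModel μ D γ h) (h0 : 0 < h 0)
    (hs : Tendsto s atTop atTop) (hsn : ∀ n : ℕ, s n ^ Module.finrank ℝ T = intensity h * n)
    {r : ℝ} (hr : 0 ≤ r) :
    Tendsto (fun n : ℕ => μ.real {x | gnomonicDepth ((s n)⁻¹ * r) < D x} ^ (n - 1)) atTop
      (𝓝 (Real.exp (-(r / √2) ^ Module.finrank ℝ T))) := by
  have h1 : Tendsto (fun n : ℕ => μ.real {x | gnomonicDepth ((s n)⁻¹ * r) < D x}) atTop (𝓝 1) := by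
    have := (H.tendsto_nat_mul_cdf h0 hs hsn hr).mul tendsto_inv_atTop_nhds_zero_nat
    rw [mul_zero] at this
    have h2 := this.const_sub 1
    rw [sub_zero] at h2
    refine h2.congr' ?_
    filter_upwards [eventually_gt_atTop 0] with n hn
    rw [H.measureReal_depth_gt]
    field_simp
  have h2 := (H.tendsto_depth_gt_pow h0 hs hsn hr).div h1 one_ne_zero
  rw [div_one] at h2
  refine h2.congr' ?_
  filter_upwards [eventually_gt_atTop 0, h1.eventually (lt_mem_nhds one_half_lt_one)] with n hn hn'
  obtain ⟨k, rfl⟩ := Nat.exists_eq_succ_of_ne_zero hn.ne'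
  rw [Pi.div_apply, Nat.succ_eq_add_one, Nat.add_sub_cancel, pow_succ, mul_div_cancel_right₀]
  linarith

theorem measurable_measureReal_depth_gt (H : IsGnomonicModel μ D γ h) :
    Measurable fun x => μ.real {y | D x < D y} :=
  (measurable_measure_prodMk_left (measurableSet_lt (H.measurable_depth.comp measurable_fst)
    (H.measurable_depth.comp measurable_snd))).ennreal_toReal

/-- The contribution of the point of least depth, in the limit. -/
theorem tendsto_nearest_term (H : IsGnomonicModel μ D γ h) (h0 : 0 < h 0)
    (hs : Tendsto s atTop atTop) (hsn : ∀ n : ℕ, s n ^ Module.finrank ℝ T = intensity h * n)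
    {L M : ℝ} (hL : 0 ≤ L) {g : ℕ → S → ℝ} (hgm : ∀ n, Measurable (g n))
    (hgM : ∀ n x, |g n x| ≤ M) {φ : T → ℝ}
    (hg : ∀ u, Tendsto (fun n => g n (γ ((s n)⁻¹ • u))) atTop (𝓝 (φ u))) :
    Tendsto (fun n : ℕ => n * ∫ x in {x | D x ≤ gnomonicDepth ((s n)⁻¹ * L)},
        g n x * μ.real {y | D x < D y} ^ (n - 1) ∂μ) atTop
      (𝓝 (h 0 / intensity h * ∫ u in Metric.closedBall (0 : T) L,
        φ u * Real.exp (-(‖u‖ / √2) ^ Module.finrank ℝ T))) := by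
  have hC := intensity_pos h0
  have hA : ∀ a, MeasurableSet {x | D x ≤ a} := fun a =>
    measurableSet_le H.measurable_depth measurable_const
  have hM0 : 0 ≤ M := (abs_nonneg _).trans (hgM 0 (γ 0))
  -- The integrand lives on the cap of scaled radius `L`, where inserting the required exponential
  -- weight costs at most `exp (L ^ 2 / 4)`. Dividing by the intensity turns `s n ^ m` into `n`.
  have h1 := (H.tendsto_scaled_integral hs (c := M * Real.exp (L ^ 2 / 4)) (by positivity)
    (Φ := fun n => {x | D x ≤ gnomonicDepth ((s n)⁻¹ * L)}.indicator
      fun x => g n x * μ.real {y | D x < D y} ^ (n - 1))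
    (.of_forall fun n => ((hgm n).mul (H.measurable_measureReal_depth_gt.pow_const _)).indicator
      (hA _)) ?_
    (φ := (Metric.closedBall (0 : T) L).indicator
      fun u => φ u * Real.exp (-(‖u‖ / √2) ^ Module.finrank ℝ T)) ?_).const_mul (intensity h)⁻¹
  · rw [integral_indicator Metric.isClosed_closedBall.measurableSet, ← mul_assoc,
      inv_mul_eq_div] at h1
    refine h1.congr fun n => ?_
    rw [hsn, mul_assoc, inv_mul_cancel_left₀ hC.ne', integral_indicator (hA _)]
  · filter_upwards [hs.eventually_gt_atTop 0] with i hi x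
    by_cases hx : D x ≤ gnomonicDepth ((s i)⁻¹ * L)
    · rw [Set.indicator_of_mem (by exact hx), abs_mul, mul_assoc]
      refine mul_le_mul (hgM _ _) ?_ (abs_nonneg _) hM0
      refine le_trans ?_ (one_le_exp_of_depth_le hi hx)
      rw [abs_of_nonneg (by positivity)]
      exact pow_le_one₀ measureReal_nonneg measureReal_le_one
    · rw [Set.indicator_of_notMem (by exact hx), abs_zero]
      positivity
  · refine ae_of_all _ fun u => ?_
    have hev : ∀ᶠ n in atTop, D (γ ((s n)⁻¹ • u)) ≤ gnomonicDepth ((s n)⁻¹ * L) ↔ ‖u‖ ≤ L := by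
      filter_upwards [hs.eventually_gt_atTop 0] with i hi
      rw [H.depth_chart_smul hi, gnomonicDepth_le_iff (by positivity) (by positivity),
        mul_le_mul_iff_right₀ (by positivity)]
    by_cases hu : ‖u‖ ≤ L
    · rw [Set.indicator_of_mem (by simpa using hu)]
      refine ((hg u).mul (H.tendsto_depth_gt_pow_sub_one h0 hs hsn (norm_nonneg u))).congr' ?_
      filter_upwards [hev, hs.eventually_gt_atTop 0] with i hi hsi
      rw [Set.indicator_of_mem (by exact hi.2 hu), H.depth_chart_smul hsi]
    · rw [Set.indicator_of_notMem (by simpa using hu)]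
      refine tendsto_const_nhds.congr' ?_
      filter_upwards [hev] with i hi
      rw [Set.indicator_of_notMem (show γ ((s i)⁻¹ • u) ∉ {x | D x ≤ _} from fun h => hu (hi.1 h))]

end Sequence

end IsGnomonicModel

/-! ### Pairs of competing points -/

/-- Bound for the effect of a point `y` on the attention output when `x` is closer to the query,
within depth `a`. -/
noncomputable def pairWeight {S : Type*} (D : S → ℝ) (β s a A B : ℝ) (x y : S) : ℝ :=
  {p : S × S | D p.1 ≤ a ∧ D p.1 ≤ D p.2}.indicator
    (fun p => Real.exp (-(β * (D p.2 - D p.1))) * (A + B * (s * √(D p.2)))) (x, y)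

section PairWeight

variable {S : Type*} {D : S → ℝ} {β s a A B : ℝ}

theorem pairWeight_of_le {x y : S} (hx : D x ≤ a) (hxy : D x ≤ D y) :
    pairWeight D β s a A B x y =
      Real.exp (-(β * (D y - D x))) * (A + B * (s * √(D y))) := by
  exact Set.indicator_of_mem (s := {p : S × S | D p.1 ≤ a ∧ D p.1 ≤ D p.2}) ⟨hx, hxy⟩ _

theorem pairWeight_of_not {x y : S} (h : ¬(D x ≤ a ∧ D x ≤ D y)) :
    pairWeight D β s a A B x y = 0 := by
  exact Set.indicator_of_notMem (s := {p : S × S | D p.1 ≤ a ∧ D p.1 ≤ D p.2}) h _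

theorem pairWeight_nonneg (hA : 0 ≤ A) (hB : 0 ≤ B) (hs : 0 ≤ s) (x y : S) :
    0 ≤ pairWeight D β s a A B x y := by
  refine Set.indicator_nonneg (fun p _ => ?_) _
  positivity

theorem measurable_pairWeight [MeasurableSpace S] (hD : Measurable D) :
    Measurable (Function.uncurry (pairWeight D β s a A B)) := by
  refine Measurable.indicator (by fun_prop) ?_
  have h1 : MeasurableSet {p : S × S | D p.1 ≤ a} :=
    measurableSet_le (by fun_prop) measurable_const
  have h2 : MeasurableSet {p : S × S | D p.1 ≤ D p.2} :=
    measurableSet_le (by fun_prop) (by fun_prop)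
  exact h1.inter h2

/-- The cap bounds `s ^ 2 * D x` by `L ^ 2 / 2`, so `β ≥ s ^ 2` leaves decay `exp (-s ^ 2 * D y)`.
Half of this exponent absorbs the factor growing like `s * √(D y)`; the rest gives domination
uniform in `x`. -/
theorem pairWeight_le (hA : 0 ≤ A) (hB : 0 ≤ B) (hs : 0 < s) (hβ : s ^ 2 ≤ β) {L : ℝ}
    (hD : ∀ x, 0 ≤ D x) (x y : S) :
    pairWeight D β s (gnomonicDepth (s⁻¹ * L)) A B x y ≤
      2 * (A + B) * Real.exp (L ^ 2 / 2) * Real.exp (-(s ^ 2 * D y / 2)) := by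
  by_cases h : D x ≤ gnomonicDepth (s⁻¹ * L) ∧ D x ≤ D y
  · rw [pairWeight_of_le h.1 h.2]
    have hx : s ^ 2 * D x ≤ L ^ 2 / 2 := by
      calc s ^ 2 * D x ≤ s ^ 2 * ((s⁻¹ * L) ^ 2 / 2) := by
            gcongr
            exact h.1.trans (gnomonicDepth_le _)
        _ = L ^ 2 / 2 := by field_simp
    set t := s ^ 2 * D y with ht
    have ht0 : 0 ≤ t := mul_nonneg (by positivity) (hD y)
    have hst : s * √(D y) = √t := by
      rw [ht, Real.sqrt_mul (by positivity), Real.sqrt_sq hs.le]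
    have hsq : √t ≤ 1 + t := Real.sqrt_le_iff.2 ⟨by positivity, by nlinarith⟩
    have h1 : 1 + t ≤ 2 * Real.exp (t / 2) := by
      have := Real.add_one_le_exp (t / 2)
      linarith
    have h2 : A + B * √t ≤ (A + B) * (2 * Real.exp (t / 2)) := by
      rw [add_mul]
      have : 1 ≤ 2 * Real.exp (t / 2) := by linarith
      nlinarith
    have h3 : Real.exp (-(β * (D y - D x))) ≤ Real.exp (L ^ 2 / 2) * Real.exp (-t) := by
      rw [← Real.exp_add, Real.exp_le_exp]
      have : s ^ 2 * (D y - D x) ≤ β * (D y - D x) :=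
        mul_le_mul_of_nonneg_right hβ (by linarith [h.2])
      nlinarith
    rw [hst]
    calc Real.exp (-(β * (D y - D x))) * (A + B * √t)
        ≤ (Real.exp (L ^ 2 / 2) * Real.exp (-t)) * ((A + B) * (2 * Real.exp (t / 2))) := by
          gcongr
      _ = 2 * (A + B) * Real.exp (L ^ 2 / 2) * (Real.exp (-t) * Real.exp (t / 2)) := by ring
      _ = _ := by
          rw [← Real.exp_add]
          ring_nf
  · rw [pairWeight_of_not h]
    positivity

end PairWeight

namespace IsGnomonicModel

variable {S T : Type*} [MeasurableSpace S] [NormedAddCommGroup T] [InnerProductSpace ℝ T]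
  [FiniteDimensional ℝ T] [MeasurableSpace T] [BorelSpace T] {μ : Measure S} {D : S → ℝ}
  {γ : T → S} {h : T → ℝ} {s : ℕ → ℝ}

/-- If `u'` is closer than `u`, the indicator vanishes. If it is farther, the scaled depth gap has a
positive limit and is multiplied by `β n / s n ^ 2 → ∞`. Equal norms are excluded, as the scaled gap
is then zero. -/
theorem tendsto_pairWeight_chart (H : IsGnomonicModel μ D γ h)
    (hs : Tendsto s atTop atTop) {β : ℕ → ℝ} (hβ : Tendsto (fun n => β n / s n ^ 2) atTop atTop)
    (L A B : ℝ) {u u' : T} (hu : ‖u'‖ ≠ ‖u‖) :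
    Tendsto (fun n => pairWeight D (β n) (s n) (gnomonicDepth ((s n)⁻¹ * L)) A B
      (γ ((s n)⁻¹ • u)) (γ ((s n)⁻¹ • u'))) atTop (𝓝 0) := by
  rcases lt_or_gt_of_ne hu with hlt | hgt
  · refine tendsto_const_nhds.congr' ?_
    filter_upwards [hs.eventually_gt_atTop 0] with n hn
    rw [pairWeight_of_not]
    rintro ⟨-, h2⟩
    rw [H.depth_chart_smul hn, H.depth_chart_smul hn,
      gnomonicDepth_le_iff (by positivity) (by positivity),
      mul_le_mul_iff_right₀ (by positivity)] at h2
    exact absurd h2 (not_le.2 hlt)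
  · have h1 := tendsto_sq_mul_gnomonicDepth hs ‖u‖
    have h2 := tendsto_sq_mul_gnomonicDepth hs ‖u'‖
    have h3 : Tendsto (fun n => Real.exp (-(β n / s n ^ 2 *
        (s n ^ 2 * gnomonicDepth ((s n)⁻¹ * ‖u'‖) - s n ^ 2 * gnomonicDepth ((s n)⁻¹ * ‖u‖)))))
        atTop (𝓝 0) := by
      refine Real.tendsto_exp_neg_atTop_nhds_zero.comp (hβ.atTop_mul_pos ?_ (h2.sub h1))
      have := norm_nonneg u
      nlinarith
    have h4 := h3.mul ((h2.sqrt.const_mul B).const_add A)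
    rw [zero_mul] at h4
    have h5 := h4.abs
    rw [abs_zero] at h5
    refine squeeze_zero_norm' ?_ h5
    filter_upwards [hs.eventually_gt_atTop 0] with n hn
    rw [Real.norm_eq_abs]
    by_cases h : D (γ ((s n)⁻¹ • u)) ≤ gnomonicDepth ((s n)⁻¹ * L) ∧
        D (γ ((s n)⁻¹ • u)) ≤ D (γ ((s n)⁻¹ • u'))
    · rw [pairWeight_of_le h.1 h.2, H.depth_chart_smul hn, H.depth_chart_smul hn,
        Real.sqrt_mul (by positivity), Real.sqrt_sq hn.le, ← mul_sub, ← mul_assoc (β n / _),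
        div_mul_cancel₀ _ (by positivity)]
    · rw [pairWeight_of_not h, abs_zero]
      positivity

/-- Pairs of points of comparable depth do not contribute in the limit. -/
theorem tendsto_pair_term [Nontrivial T] [IsProbabilityMeasure μ]
    (H : IsGnomonicModel μ D γ h) (h0 : 0 < h 0)
    (hs : Tendsto s atTop atTop) (hsn : ∀ n : ℕ, s n ^ Module.finrank ℝ T = intensity h * n)
    {β : ℕ → ℝ} (hβ : Tendsto (fun n => β n / s n ^ 2) atTop atTop)
    {L A B : ℝ} (hA : 0 ≤ A) (hB : 0 ≤ B) :
    Tendsto (fun n : ℕ => (n : ℝ) ^ 2 * ∫ x, ∫ y,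
      pairWeight D (β n) (s n) (gnomonicDepth ((s n)⁻¹ * L)) A B x y ∂μ ∂μ) atTop (𝓝 0) := by
  have hC := intensity_pos h0
  set m := Module.finrank ℝ T
  set k : ℕ → S → S → ℝ := fun n =>
    pairWeight D (β n) (s n) (gnomonicDepth ((s n)⁻¹ * L)) A B
  have hkm : ∀ n, Measurable (Function.uncurry (k n)) := fun n =>
    measurable_pairWeight H.measurable_depth
  set c₀ : ℝ := 2 * (A + B) * Real.exp (L ^ 2 / 2)
  have hc₀ : 0 ≤ c₀ := by positivity
  have hev : ∀ᶠ n in atTop, 0 < s n ∧ s n ^ 2 ≤ β n := by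
    filter_upwards [hs.eventually_gt_atTop 0, hβ.eventually_ge_atTop 1] with n hn hb
    exact ⟨hn, (one_le_div (by positivity)).1 hb⟩
  have hk0 : ∀ᶠ n in atTop, ∀ x y, 0 ≤ k n x y := by
    filter_upwards [hev] with n hn x y
    exact pairWeight_nonneg hA hB hn.1.le x y
  have hk : ∀ᶠ n in atTop, ∀ x y, |k n x y| ≤ c₀ * Real.exp (-(s n ^ 2 * D y / 2)) := by
    filter_upwards [hev, hk0] with n hn h0 x y
    rw [abs_of_nonneg (h0 x y)]
    exact pairWeight_le hA hB hn.1 hn.2 H.depth_nonneg x y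
  have hDm := H.measurable_depth
  have hem : ∀ n, Measurable fun y => Real.exp (-(s n ^ 2 * D y / 2)) := fun n => by fun_prop
  have hQ := H.tendsto_scaled_integral hs (c := 1) zero_le_one
    (Φ := fun n y => Real.exp (-(s n ^ 2 * D y / 2))) (.of_forall hem)
    (.of_forall fun n y => by rw [one_mul, abs_of_pos (Real.exp_pos _)])
    (φ := fun u => Real.exp (-(‖u‖ ^ 2 / 2 / 2))) (ae_of_all _ fun u => by
      refine Tendsto.congr' ?_ (((tendsto_sq_mul_gnomonicDepth hs ‖u‖).div_const 2).neg.rexp)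
      filter_upwards [hs.eventually_gt_atTop 0] with n hn
      rw [H.depth_chart_smul hn])
  set Q := h 0 * ∫ u : T, Real.exp (-(‖u‖ ^ 2 / 2 / 2))
  have hQ0 : 0 ≤ Q := mul_nonneg h0.le (integral_nonneg fun _ => by positivity)
  -- For fixed `u`, the points `u'` of equal norm form a sphere, which is null.
  have hinner : ∀ u : T, Tendsto (fun n => s n ^ m * ∫ y, k n (γ ((s n)⁻¹ • u)) y ∂μ) atTop
      (𝓝 0) := by
    intro u
    have := H.tendsto_scaled_integral hs hc₀
      (Φ := fun n y => k n (γ ((s n)⁻¹ • u)) y)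
      (.of_forall fun n => (hkm n).of_uncurry_left)
      (by filter_upwards [hk] with n hn y using hn _ y) (φ := fun _ => 0) ?_
    · simpa using this
    · have hnull : ∀ᵐ u' : T, u' ∉ Metric.sphere (0 : T) ‖u‖ :=
        measure_eq_zero_iff_ae_notMem.1 (Measure.addHaar_sphere _ _ _)
      filter_upwards [hnull] with u' hu'
      exact H.tendsto_pairWeight_chart hs hβ L A B (by simpa using hu')
  -- Rescaling is applied a second time, to the inner integral already multiplied by `s n ^ m`. The
  -- two powers together amount to `(intensity h * n) ^ 2`. The domination uses the bound in `y`
  -- uniform over `x`, and the vanishing of the weight when `x` is outside the cap.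
  have houter := H.tendsto_scaled_integral hs
    (c := c₀ * (Q + 1) * Real.exp (L ^ 2 / 4)) (by positivity)
    (Φ := fun n x => s n ^ m * ∫ y, k n x y ∂μ)
    (.of_forall fun n => ((hkm n).stronglyMeasurable.integral_prod_right).measurable.const_mul _)
    ?_ (φ := fun _ => 0) (ae_of_all _ hinner)
  · simp only [integral_zero, mul_zero] at houter
    have := houter.const_mul ((intensity h)⁻¹ ^ 2)
    rw [mul_zero] at this
    refine this.congr fun n => ?_
    change _ = (n : ℝ) ^ 2 * ∫ x, ∫ y, k n x y ∂μ ∂μ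
    rw [integral_const_mul, hsn]
    generalize ∫ x, ∫ y, k n x y ∂μ ∂μ = I
    field_simp
  · filter_upwards [hev, hk, hQ.eventually_lt_const (lt_add_one Q)] with n hn hkn hQn x
    by_cases hx : D x ≤ gnomonicDepth ((s n)⁻¹ * L)
    · have hpow : 0 ≤ s n ^ m := pow_nonneg hn.1.le _
      have h1 : |∫ y, k n x y ∂μ| ≤ c₀ * ∫ y, Real.exp (-(s n ^ 2 * D y / 2)) ∂μ := by
        rw [← integral_const_mul, ← Real.norm_eq_abs]
        refine norm_integral_le_of_norm_le (Integrable.const_mul ?_ _) (ae_of_all _ fun y => hkn x y)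
        refine Integrable.of_bound (hem n).aestronglyMeasurable 1 (ae_of_all _ fun y => ?_)
        rw [Real.norm_eq_abs, abs_of_pos (Real.exp_pos _), Real.exp_le_one_iff]
        have := H.depth_nonneg y
        simp only [Left.neg_nonpos_iff]
        positivity
      have h2 : |s n ^ m * ∫ y, k n x y ∂μ| ≤ c₀ * (Q + 1) := by
        rw [abs_mul, abs_of_nonneg hpow]
        calc s n ^ m * |∫ y, k n x y ∂μ|
            ≤ s n ^ m * (c₀ * ∫ y, Real.exp (-(s n ^ 2 * D y / 2)) ∂μ) := by gcongr
          _ = c₀ * (s n ^ m * ∫ y, Real.exp (-(s n ^ 2 * D y / 2)) ∂μ) := by ring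
          _ ≤ _ := by gcongr
      refine h2.trans ?_
      rw [mul_assoc (c₀ * (Q + 1))]
      exact le_mul_of_one_le_right (by positivity) (one_le_exp_of_depth_le hn.1 hx)
    · have : ∀ y, k n x y = 0 := fun y => pairWeight_of_not fun h => hx h.1
      simp only [this, integral_zero, mul_zero, abs_zero]
      positivity

end IsGnomonicModel

/-! ### Softmax compared with the nearest point -/

/-- The distance-to-query `1 - ⟨q, x⟩`. -/
noncomputable def queryDepth {d : ℕ} (q x : UnitSphere d) : ℝ :=
  1 - inner ℝ (q : EuclideanSpace ℝ (Fin d)) x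

theorem measurable_queryDepth {d : ℕ} (q : UnitSphere d) : Measurable (queryDepth q) := by
  unfold queryDepth; fun_prop

theorem norm_sub_query {d : ℕ} (q x : UnitSphere d) :
    ‖(x : EuclideanSpace ℝ (Fin d)) - q‖ = √(2 * queryDepth q x) := by
  have h : ‖(x : EuclideanSpace ℝ (Fin d)) - q‖ ^ 2 = 2 * queryDepth q x := by
    rw [norm_sub_sq_real, norm_eq_of_mem_sphere, norm_eq_of_mem_sphere, real_inner_comm, queryDepth]
    ring
  rw [← h, Real.sqrt_sq (norm_nonneg _)]

theorem queryDepth_nonneg {d : ℕ} (q x : UnitSphere d) : 0 ≤ queryDepth q x := by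
  have := real_inner_le_norm (q : EuclideanSpace ℝ (Fin d)) (x : EuclideanSpace ℝ (Fin d))
  simp only [norm_eq_of_mem_sphere, mul_one] at this
  rw [queryDepth]; linarith

/-- Configurations in which the `i`-th point is the strict minimiser of `D`, of value at most
`a`. -/
def nearestSet {S : Type*} (D : S → ℝ) (a : ℝ) {n : ℕ} (i : Fin n) : Set (Fin n → S) :=
  {x | D (x i) ≤ a ∧ ∀ j ≠ i, D (x i) < D (x j)}

section Attention

variable {d n : ℕ} {β : ℝ} {q : UnitSphere d} {x : Fin n → UnitSphere d}

theorem attentionWeight_nonneg (j : Fin n) : 0 ≤ attentionWeight β q x j := by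
  unfold attentionWeight; positivity

theorem sum_attentionWeight (hn : 0 < n) : ∑ j, attentionWeight β q x j = 1 := by
  have : Nonempty (Fin n) := ⟨⟨0, hn⟩⟩
  unfold attentionWeight
  rw [← Finset.sum_div, div_self]
  exact (Finset.sum_pos (fun _ _ => Real.exp_pos _) Finset.univ_nonempty).ne'

/-- The denominator is at least its `i`-th term. -/
theorem attentionWeight_le (i j : Fin n) :
    attentionWeight β q x j ≤ Real.exp (-(β * (queryDepth q (x j) - queryDepth q (x i)))) := by
  have h : -(β * (queryDepth q (x j) - queryDepth q (x i))) =
      β * inner ℝ (q : EuclideanSpace ℝ (Fin d)) (x j) -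
        β * inner ℝ (q : EuclideanSpace ℝ (Fin d)) (x i) := by
    unfold queryDepth; ring
  rw [h, Real.exp_sub, attentionWeight]
  gcongr
  exact Finset.single_le_sum
    (f := fun l => Real.exp (β * inner ℝ (q : EuclideanSpace ℝ (Fin d)) (x l)))
    (fun _ _ => (Real.exp_pos _).le) (Finset.mem_univ i)

theorem attention_sub_point_norm_le (hn : 0 < n) {i : Fin n}
    (hi : ∀ j, queryDepth q (x i) ≤ queryDepth q (x j)) :
    ‖∑ j, attentionWeight β q x j • (x j : EuclideanSpace ℝ (Fin d)) - x i‖ ≤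
      ∑ j ∈ Finset.univ.erase i,
        Real.exp (-(β * (queryDepth q (x j) - queryDepth q (x i)))) *
          (3 * √(queryDepth q (x j))) := by
  have h1 : ∑ j, attentionWeight β q x j • (x j : EuclideanSpace ℝ (Fin d)) - x i =
      ∑ j ∈ Finset.univ.erase i, attentionWeight β q x j •
        ((x j : EuclideanSpace ℝ (Fin d)) - x i) := by
    rw [Finset.sum_erase _ (by simp)]
    simp_rw [smul_sub]
    rw [Finset.sum_sub_distrib, ← Finset.sum_smul, sum_attentionWeight hn, one_smul]
  rw [h1]
  refine (norm_sum_le _ _).trans (Finset.sum_le_sum fun j _ => ?_)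
  rw [norm_smul, Real.norm_eq_abs, abs_of_nonneg (attentionWeight_nonneg j)]
  refine mul_le_mul (attentionWeight_le i j) ?_ (norm_nonneg _) (Real.exp_pos _).le
  -- Both points lie within `√(2 * D (x j))` of `q`, so their distance is at most `2√2 * √(D (x
  -- j))`; the constant `3` bounds `2√2`.
  have h2 : √2 ≤ 3 / 2 := Real.sqrt_le_iff.2 ⟨by norm_num, by norm_num⟩
  have h3 : √(queryDepth q (x i)) ≤ √(queryDepth q (x j)) := Real.sqrt_le_sqrt (hi j)
  calc ‖(x j : EuclideanSpace ℝ (Fin d)) - x i‖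
      = ‖((x j : EuclideanSpace ℝ (Fin d)) - q) - (x i - q)‖ := by rw [sub_sub_sub_cancel_right]
    _ ≤ √(2 * queryDepth q (x j)) + √(2 * queryDepth q (x i)) := by
        rw [← norm_sub_query, ← norm_sub_query]
        exact norm_sub_le _ _
    _ = √2 * √(queryDepth q (x j)) + √2 * √(queryDepth q (x i)) := by
        rw [Real.sqrt_mul (by norm_num), Real.sqrt_mul (by norm_num)]
    _ ≤ _ := by
        have h4 := Real.sqrt_nonneg (queryDepth q (x j))
        have h5 := Real.sqrt_nonneg (2 : ℝ)
        nlinarith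

/-- Pointwise comparison of the attention output with the nearest context point. -/
theorem abs_sub_nearest_le (hn : 0 < n) {f : EuclideanSpace ℝ (Fin d) → ℝ} {M : ℝ}
    (hM : ∀ z, |f z| ≤ M) {K : NNReal} (hK : LipschitzWith K f) {s : ℝ} (hs : 0 ≤ s) (a : ℝ) :
    |f (s • (∑ j, attentionWeight β q x j • (x j : EuclideanSpace ℝ (Fin d)) - q)) -
      ∑ i, (nearestSet (queryDepth q) a i).indicator
          (fun x => f (s • ((x i : EuclideanSpace ℝ (Fin d)) - q))) x| ≤
      {x : Fin n → UnitSphere d | ∀ i, a < queryDepth q (x i)}.indicator (fun _ => M) x +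
      ∑ i, ∑ j ∈ Finset.univ.erase i,
        pairWeight (queryDepth q) β s a M (3 * K) (x i) (x j) := by
  have hM0 : 0 ≤ M := (abs_nonneg _).trans (hM 0)
  set Y : EuclideanSpace ℝ (Fin d) := ∑ j, attentionWeight β q x j • (x j : EuclideanSpace ℝ (Fin d))
    with hY
  have hp : ∀ i j, 0 ≤ pairWeight (queryDepth q) β s a M (3 * K) (x i) (x j) := fun i j =>
    pairWeight_nonneg hM0 (by positivity) hs _ _
  have hpp : ∀ i, 0 ≤ ∑ j ∈ Finset.univ.erase i,
      pairWeight (queryDepth q) β s a M (3 * K) (x i) (x j) := fun i =>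
    Finset.sum_nonneg fun j _ => hp i j
  -- If the cap is empty, every nearest-point indicator vanishes and the bound `M` suffices.
  by_cases hall : ∀ i, a < queryDepth q (x i)
  · rw [Finset.sum_eq_zero, sub_zero, Set.indicator_of_mem (by exact hall)]
    · have := Finset.sum_nonneg fun i (_ : i ∈ Finset.univ) => hpp i
      linarith [hM (s • (Y - q))]
    · intro i _
      exact Set.indicator_of_notMem (fun h => absurd h.1 (not_le.2 (hall i))) _
  · have : Nonempty (Fin n) := ⟨⟨0, hn⟩⟩
    obtain ⟨i, hi⟩ := Finite.exists_min fun i => queryDepth q (x i)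
    have hia : queryDepth q (x i) ≤ a := by
      push Not at hall
      obtain ⟨k, hk⟩ := hall
      exact (hi k).trans hk
    rw [Set.indicator_of_notMem (by exact hall), zero_add]
    refine le_trans ?_ (Finset.single_le_sum (fun i _ => hpp i) (Finset.mem_univ i))
    -- At most one index can be a strict minimiser, so only the chosen minimiser `i` can contribute.
    rw [Finset.sum_eq_single_of_mem i (Finset.mem_univ i)]
    swap
    · intro k _ hki
      exact Set.indicator_of_notMem (fun h => absurd (h.2 i hki.symm) (not_lt.2 (hi k))) _
    by_cases hstrict : ∀ j ≠ i, queryDepth q (x i) < queryDepth q (x j)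
    · rw [Set.indicator_of_mem (show x ∈ nearestSet (queryDepth q) a i from ⟨hia, hstrict⟩)]
      have h1 := hK.dist_le_mul (s • (Y - q)) (s • ((x i : EuclideanSpace ℝ (Fin d)) - q))
      rw [Real.dist_eq, dist_eq_norm, ← smul_sub, sub_sub_sub_cancel_right, norm_smul,
        Real.norm_eq_abs, abs_of_nonneg hs] at h1
      refine h1.trans ?_
      have h2 := attention_sub_point_norm_le (β := β) hn hi
      calc (K : ℝ) * (s * ‖Y - x i‖)
          ≤ K * (s * ∑ j ∈ Finset.univ.erase i,
              Real.exp (-(β * (queryDepth q (x j) - queryDepth q (x i)))) *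
                (3 * √(queryDepth q (x j)))) := by gcongr
        _ ≤ _ := by
          rw [Finset.mul_sum, Finset.mul_sum]
          refine Finset.sum_le_sum fun j _ => ?_
          rw [pairWeight_of_le hia (hi j), mul_add]
          have : 0 ≤ Real.exp (-(β * (queryDepth q (x j) - queryDepth q (x i)))) * M := by positivity
          nlinarith
    -- In a tie the nearest-point sum is zero and the error can be as large as `M`. A pair with zero
    -- gap has weight at least `M`, which is why the constant term is present in `pairWeight`.
    · rw [Set.indicator_of_notMem (show x ∉ nearestSet (queryDepth q) a i from fun h => hstrict h.2), sub_zero]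
      push Not at hstrict
      obtain ⟨j, hji, hj⟩ := hstrict
      have hj' : queryDepth q (x j) = queryDepth q (x i) := le_antisymm hj (hi j)
      refine (hM _).trans (le_trans ?_ (Finset.single_le_sum (fun j _ => hp i j)
        (Finset.mem_erase.2 ⟨hji, Finset.mem_univ j⟩)))
      rw [pairWeight_of_le hia (hi j), hj', sub_self, mul_zero, neg_zero, Real.exp_zero, one_mul]
      have : 0 ≤ 3 * (K : ℝ) * (s * √(queryDepth q (x i))) := by positivity
      linarith

end Attention

/-! ### Expectations for an i.i.d. context -/

section IID

variable {S : Type*} [MeasurableSpace S] {μ : Measure S} [IsProbabilityMeasure μ] {D : S → ℝ}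

theorem pi_real_forall_lt (n : ℕ) (a : ℝ) :
    (Measure.pi fun _ : Fin n => μ).real {y | ∀ j, a < D (y j)} = μ.real {y | a < D y} ^ n := by
  have : {y : Fin n → S | ∀ j, a < D (y j)} = Set.univ.pi fun _ => {y | a < D y} := by
    ext; simp
  rw [this, measureReal_def, Measure.pi_pi, ENNReal.toReal_prod]
  simp [measureReal_def]

/-- Fubini splits off the `i`-th coordinate; given its value `x`, the other `n - 1` coordinates are
independently deeper than `x`. -/
theorem integral_pi_nearest (hD : Measurable D) {g : S → ℝ} (hg : Measurable g) {M : ℝ}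
    (hM : ∀ x, |g x| ≤ M) {n : ℕ} (a : ℝ) (i : Fin n) :
    ∫ x, (nearestSet D a i).indicator (fun x => g (x i)) x ∂(Measure.pi fun _ : Fin n => μ) =
      ∫ x in {x | D x ≤ a}, g x * μ.real {y | D x < D y} ^ (n - 1) ∂μ := by
  obtain ⟨k, rfl⟩ := Nat.exists_eq_succ_of_ne_zero (Fin.pos i).ne'
  let G : S × (Fin k → S) → ℝ :=
    {p | D p.1 ≤ a ∧ ∀ j, D p.1 < D (p.2 j)}.indicator fun p => g p.1
  have hset : MeasurableSet {p : S × (Fin k → S) | D p.1 ≤ a ∧ ∀ j, D p.1 < D (p.2 j)} := by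
    have h1 : MeasurableSet {p : S × (Fin k → S) | D p.1 ≤ a} :=
      measurableSet_le (by fun_prop) measurable_const
    have h2 : MeasurableSet {p : S × (Fin k → S) | ∀ j, D p.1 < D (p.2 j)} := by
      have : {p : S × (Fin k → S) | ∀ j, D p.1 < D (p.2 j)} =
          ⋂ j, {p : S × (Fin k → S) | D p.1 < D (p.2 j)} := by ext; simp
      rw [this]
      exact MeasurableSet.iInter fun j => measurableSet_lt (by fun_prop) (by fun_prop)
    exact h1.inter h2
  have hG : Measurable G := (hg.comp measurable_fst).indicator hset
  have hGi : Integrable G (μ.prod (Measure.pi fun _ : Fin k => μ)) := by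
    refine Integrable.of_bound hG.aestronglyMeasurable M (ae_of_all _ fun p => ?_)
    exact (norm_indicator_le_norm_self _ _).trans (hM _)
  calc _ = ∫ x, G (MeasurableEquiv.piFinSuccAbove (fun _ => S) i x)
          ∂(Measure.pi fun _ : Fin (k + 1) => μ) := by
        congr with x
        have hiff : (∀ j ≠ i, D (x i) < D (x j)) ↔ ∀ j, D (x i) < D (x (i.succAbove j)) := by
          constructor
          · exact fun h j => h _ (Fin.succAbove_ne i j)
          · intro h j hj
            obtain ⟨j', rfl⟩ := Fin.exists_succAbove_eq hj
            exact h j'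
        by_cases hx : D (x i) ≤ a ∧ ∀ j ≠ i, D (x i) < D (x j)
        · rw [Set.indicator_of_mem (show x ∈ nearestSet D a i from hx)]
          have hx' : MeasurableEquiv.piFinSuccAbove (fun _ => S) i x ∈
              {p : S × (Fin k → S) | D p.1 ≤ a ∧ ∀ j, D p.1 < D (p.2 j)} :=
            ⟨hx.1, hiff.1 hx.2⟩
          exact (Set.indicator_of_mem hx' fun p => g p.1).symm
        · rw [Set.indicator_of_notMem (show x ∉ nearestSet D a i from hx)]
          have hx' : MeasurableEquiv.piFinSuccAbove (fun _ => S) i x ∉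
              {p : S × (Fin k → S) | D p.1 ≤ a ∧ ∀ j, D p.1 < D (p.2 j)} :=
            fun h => hx ⟨h.1, hiff.2 h.2⟩
          exact (Set.indicator_of_notMem hx' fun p => g p.1).symm
    _ = ∫ p, G p ∂(μ.prod (Measure.pi fun _ : Fin k => μ)) :=
        (measurePreserving_piFinSuccAbove (fun _ => μ) i).integral_comp' G
    _ = ∫ x, ∫ y, G (x, y) ∂(Measure.pi fun _ : Fin k => μ) ∂μ := integral_prod _ hGi
    _ = ∫ x, {x | D x ≤ a}.indicator (fun x => g x * μ.real {y | D x < D y} ^ k) x ∂μ := by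
        congr with x
        by_cases hx : D x ≤ a
        · have hm : MeasurableSet {y : Fin k → S | ∀ j, D x < D (y j)} := by
            have : {y : Fin k → S | ∀ j, D x < D (y j)} =
              ⋂ j, {y : Fin k → S | D x < D (y j)} := by ext; simp
            rw [this]
            exact MeasurableSet.iInter fun j => measurableSet_lt (by fun_prop) (by fun_prop)
          have h1 : ∀ y, G (x, y) =
              {y : Fin k → S | ∀ j, D x < D (y j)}.indicator (fun _ => g x) y := fun y => by
            simp [G, Set.indicator, hx]
          simp_rw [h1]
          rw [integral_indicator_const _ hm, pi_real_forall_lt, Set.indicator_of_mem (by exact hx),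
            smul_eq_mul, mul_comm]
        · have h1 : ∀ y, G (x, y) = 0 := fun y => by simp [G, hx]
          simp [h1, Set.indicator, hx]
    _ = _ := integral_indicator (measurableSet_le hD measurable_const)

end IID

theorem measurableSet_nearestSet {S : Type*} [MeasurableSpace S] {D : S → ℝ} (hD : Measurable D)
    (a : ℝ) {n : ℕ} (i : Fin n) : MeasurableSet (nearestSet D a i) := by
  have h1 : MeasurableSet {x : Fin n → S | D (x i) ≤ a} :=
    measurableSet_le (by fun_prop) measurable_const
  have h2 : MeasurableSet {x : Fin n → S | ∀ j ≠ i, D (x i) < D (x j)} := by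
    have : {x : Fin n → S | ∀ j ≠ i, D (x i) < D (x j)} =
        ⋂ j, ⋂ _ : j ≠ i, {x : Fin n → S | D (x i) < D (x j)} := by ext; simp
    rw [this]
    exact MeasurableSet.iInter fun j => MeasurableSet.iInter fun _ =>
      measurableSet_lt (by fun_prop) (by fun_prop)
  exact h1.inter h2

theorem measurable_attentionSum {d n : ℕ} (β : ℝ) (q : UnitSphere d) :
    Measurable fun x : Fin n → UnitSphere d =>
      ∑ j, attentionWeight β q x j • (x j : EuclideanSpace ℝ (Fin d)) := by
  unfold attentionWeight
  fun_prop

/-- The expectation of a test function of the attention output, compared with the contribution of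
the nearest context point. -/
theorem abs_integral_sub_nearest_le {d : ℕ} {Ω : Type*} [MeasurableSpace Ω] {P : Measure Ω}
    [IsProbabilityMeasure P] {q : UnitSphere d} {X : ℕ → Ω → UnitSphere d}
    {μ : Measure (UnitSphere d)} [IsProbabilityMeasure μ]
    (hXm : ∀ i, Measurable (X i)) (hXi : iIndepFun X P) (hXl : ∀ i, P.map (X i) = μ)
    {f : EuclideanSpace ℝ (Fin d) → ℝ} {M : ℝ} (hM : ∀ z, |f z| ≤ M) {K : NNReal}
    (hK : LipschitzWith K f) {n : ℕ} (hn : 0 < n) {s β : ℝ} (hs : 0 < s) (hβ : s ^ 2 ≤ β) (L : ℝ) :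
    |∫ ω, f (s • (∑ j : Fin n, attentionWeight β q (fun j : Fin n => X j ω) j •
          (X j ω : EuclideanSpace ℝ (Fin d)) - q)) ∂P -
      n * ∫ x in {x | queryDepth q x ≤ gnomonicDepth (s⁻¹ * L)},
        f (s • ((x : EuclideanSpace ℝ (Fin d)) - q)) *
          μ.real {y | queryDepth q x < queryDepth q y} ^ (n - 1) ∂μ| ≤
      M * μ.real {x | gnomonicDepth (s⁻¹ * L) < queryDepth q x} ^ n +
      (n : ℝ) ^ 2 * ∫ x, ∫ y,
        pairWeight (queryDepth q) β s (gnomonicDepth (s⁻¹ * L)) M (3 * K) x y ∂μ ∂μ := by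
  have hM0 : 0 ≤ M := (abs_nonneg _).trans (hM 0)
  have hD := measurable_queryDepth q
  have hfm : Measurable f := hK.continuous.measurable
  set a := gnomonicDepth (s⁻¹ * L)
  set D := queryDepth q
  set k := pairWeight D β s a M (3 * K)
  have hkm : Measurable (Function.uncurry k) := measurable_pairWeight hD
  have hk0 : ∀ x y, 0 ≤ k x y := pairWeight_nonneg hM0 (by positivity) hs.le
  have hkb : ∀ x y, ‖k x y‖ ≤ 2 * (M + 3 * K) * Real.exp (L ^ 2 / 2) := fun x y => by
    rw [Real.norm_eq_abs, abs_of_nonneg (hk0 x y)]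
    refine (pairWeight_le hM0 (by positivity) hs hβ (queryDepth_nonneg q) x y).trans ?_
    refine mul_le_of_le_one_right (by positivity) (Real.exp_le_one_iff.2 ?_)
    have := queryDepth_nonneg q y
    simp only [Left.neg_nonpos_iff]
    positivity
  let Ξ : Ω → Fin n → UnitSphere d := fun ω j => X j ω
  have hΞ : Measurable Ξ := measurable_pi_lambda _ fun j => hXm j
  have hmap : P.map Ξ = Measure.pi fun _ : Fin n => μ := by
    have h1 : iIndepFun (fun j : Fin n => X j) P := hXi.precomp Fin.val_injective
    rw [(iIndepFun_iff_map_fun_eq_pi_map fun j : Fin n => (hXm j).aemeasurable).1 h1]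
    simp_rw [hXl]
  set g : UnitSphere d → ℝ := fun x => f (s • ((x : EuclideanSpace ℝ (Fin d)) - q))
  have hgm : Measurable g := hfm.comp (by fun_prop)
  -- the nearest point contribution
  have hN : ∀ i : Fin n, Measurable ((nearestSet D a i).indicator fun x => g (x i)) := fun i =>
    (hgm.comp (measurable_pi_apply i)).indicator (measurableSet_nearestSet hD a i)
  have hNi : ∀ i : Fin n, Integrable
      (fun ω => (nearestSet D a i).indicator (fun x => g (x i)) (Ξ ω)) P := fun i =>
    Integrable.of_bound ((hN i).comp hΞ).aestronglyMeasurable M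
      (ae_of_all _ fun ω => (norm_indicator_le_norm_self _ _).trans (hM _))
  have hNv : ∀ i : Fin n, ∫ ω, (nearestSet D a i).indicator (fun x => g (x i)) (Ξ ω) ∂P =
      ∫ x in {x | D x ≤ a}, g x * μ.real {y | D x < D y} ^ (n - 1) ∂μ := fun i => by
    rw [← integral_pi_nearest hD hgm (fun x => hM _) a i, ← hmap,
      integral_map hΞ.aemeasurable (hN i).aestronglyMeasurable]
  -- the event that no point is close
  have hfarm : MeasurableSet {x : Fin n → UnitSphere d | ∀ i, a < D (x i)} := by
    have : {x : Fin n → UnitSphere d | ∀ i, a < D (x i)} = ⋂ i, {x | a < D (x i)} := by ext; simp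
    rw [this]
    exact MeasurableSet.iInter fun i => measurableSet_lt measurable_const (by fun_prop)
  have hFm : Measurable
      ({x : Fin n → UnitSphere d | ∀ i, a < D (x i)}.indicator fun _ => M) :=
    measurable_const.indicator hfarm
  have hFi : Integrable
      (fun ω => {x : Fin n → UnitSphere d | ∀ i, a < D (x i)}.indicator (fun _ => M) (Ξ ω)) P :=
    Integrable.of_bound (hFm.comp hΞ).aestronglyMeasurable M
      (ae_of_all _ fun ω => (norm_indicator_le_norm_self _ _).trans
        (by rw [Real.norm_eq_abs, abs_of_nonneg hM0]))
  have hFv : ∫ ω, {x : Fin n → UnitSphere d | ∀ i, a < D (x i)}.indicator (fun _ => M) (Ξ ω) ∂P =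
      M * μ.real {x | a < D x} ^ n := by
    rw [← integral_map hΞ.aemeasurable hFm.aestronglyMeasurable, hmap,
      integral_indicator_const _ hfarm, pi_real_forall_lt, smul_eq_mul, mul_comm]
  -- the pair contributions
  have hPi : ∀ i j : Fin n, Integrable (fun ω => k (X i ω) (X j ω)) P := fun i j =>
    Integrable.of_bound (hkm.comp ((hXm i).prodMk (hXm j))).aestronglyMeasurable _
      (ae_of_all _ fun ω => hkb _ _)
  have hPv : ∀ i j : Fin n, j ≠ i →
      ∫ ω, k (X i ω) (X j ω) ∂P = ∫ x, ∫ y, k x y ∂μ ∂μ := fun i j hij => by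
    have h1 : IndepFun (X i) (X j) P := hXi.indepFun fun h => hij (Fin.ext h.symm)
    have h2 := (indepFun_iff_map_prod_eq_prod_map_map (hXm i).aemeasurable
      (hXm j).aemeasurable).1 h1
    rw [hXl, hXl] at h2
    have h3 : Integrable (Function.uncurry k) (μ.prod μ) :=
      Integrable.of_bound hkm.aestronglyMeasurable _ (ae_of_all _ fun p => hkb p.1 p.2)
    have h4 := integral_prod _ h3
    rw [← h2, integral_map ((hXm i).prodMk (hXm j)).aemeasurable hkm.aestronglyMeasurable] at h4
    exact h4
  set F : Ω → ℝ := fun ω => f (s • (∑ j : Fin n, attentionWeight β q (fun j : Fin n => X j ω) j •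
          (X j ω : EuclideanSpace ℝ (Fin d)) - q))
  have hFint : Integrable F P := by
    refine Integrable.of_bound (Measurable.aestronglyMeasurable ?_) M (ae_of_all _ fun ω => hM _)
    exact hfm.comp ((((measurable_attentionSum β q).comp hΞ).sub_const _).const_smul s)
  have hNint : Integrable
      (fun ω => ∑ i : Fin n, (nearestSet D a i).indicator (fun x => g (x i)) (Ξ ω)) P :=
    integrable_finsetSum _ fun i _ => hNi i
  have hPint : Integrable
      (fun ω => ∑ i : Fin n, ∑ j ∈ Finset.univ.erase i, k (X i ω) (X j ω)) P :=
    integrable_finsetSum _ fun i _ => integrable_finsetSum _ fun j _ => hPi i j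
  have hNsum : ∫ ω, ∑ i : Fin n, (nearestSet D a i).indicator (fun x => g (x i)) (Ξ ω) ∂P =
      n * ∫ x in {x | D x ≤ a}, g x * μ.real {y | D x < D y} ^ (n - 1) ∂μ := by
    rw [integral_finsetSum _ fun i _ => hNi i, Finset.sum_congr rfl fun i _ => hNv i]
    simp
  have hII : 0 ≤ ∫ x, ∫ y, k x y ∂μ ∂μ := integral_nonneg fun x => integral_nonneg fun y => hk0 x y
  -- Each off-diagonal pair has law `μ.prod μ`, and the `n * (n - 1)` ordered pairs are counted
  -- crudely as `n ^ 2`.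
  have hPsum : ∫ ω, ∑ i : Fin n, ∑ j ∈ Finset.univ.erase i, k (X i ω) (X j ω) ∂P ≤
      (n : ℝ) ^ 2 * ∫ x, ∫ y, k x y ∂μ ∂μ := by
    rw [integral_finsetSum _ fun i _ => integrable_finsetSum _ fun j _ => hPi i j]
    have h1 : ∀ i : Fin n, ∫ ω, ∑ j ∈ Finset.univ.erase i, k (X i ω) (X j ω) ∂P ≤
        n * ∫ x, ∫ y, k x y ∂μ ∂μ := fun i => by
      rw [integral_finsetSum _ fun j _ => hPi i j,
        Finset.sum_congr rfl fun j hj => hPv i j (Finset.ne_of_mem_erase hj), Finset.sum_const,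
        nsmul_eq_mul]
      gcongr
      exact (Finset.card_le_univ _).trans (by simp)
    refine (Finset.sum_le_sum fun i _ => h1 i).trans (le_of_eq ?_)
    simp
    ring
  rw [← hNsum, ← integral_sub hFint hNint]
  calc _ ≤ ∫ ω, |F ω - ∑ i : Fin n, (nearestSet D a i).indicator (fun x => g (x i)) (Ξ ω)| ∂P :=
        abs_integral_le_integral_abs
    _ ≤ ∫ ω, ({x : Fin n → UnitSphere d | ∀ i, a < D (x i)}.indicator (fun _ => M) (Ξ ω) +
          ∑ i : Fin n, ∑ j ∈ Finset.univ.erase i, k (X i ω) (X j ω)) ∂P :=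
        integral_mono (hFint.sub hNint).abs (hFi.add hPint) fun ω =>
          abs_sub_nearest_le hn hM hK hs.le a
    _ ≤ _ := by
        rw [integral_add hFi hPint, hFv]
        gcongr

/-! ### The law of the limit variable -/

/-- The law on `(0, ∞)` with tail `exp (-(a / √2) ^ m)`. -/
noncomputable def radialLaw (m : ℕ) : Measure ℝ :=
  (volume.restrict (Set.Ioi 0)).withDensity fun r =>
    ENNReal.ofReal (m / √2 ^ m * r ^ (m - 1) * Real.exp (-(r / √2) ^ m))

theorem radialLaw_Ioi {m : ℕ} (hm : 0 < m) {a : ℝ} (ha : 0 ≤ a) :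
    radialLaw m (Set.Ioi a) = ENNReal.ofReal (Real.exp (-(a / √2) ^ m)) := by
  have hderiv : ∀ x ∈ Set.Ici a, HasDerivAt (fun r : ℝ => -Real.exp (-(r / √2) ^ m))
      (m / √2 ^ m * x ^ (m - 1) * Real.exp (-(x / √2) ^ m)) x := by
    intro x _
    have h1 := ((((hasDerivAt_id' x).div_const √2).pow m).neg).exp.neg
    refine h1.congr_deriv ?_
    simp only [Pi.neg_apply, Pi.pow_apply]
    obtain ⟨k, rfl⟩ := Nat.exists_eq_succ_of_ne_zero hm.ne'
    simp only [Nat.succ_eq_add_one, Nat.add_sub_cancel, pow_succ, div_pow]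
    field_simp
  have hpos : ∀ x ∈ Set.Ioi a, 0 ≤ m / √2 ^ m * x ^ (m - 1) * Real.exp (-(x / √2) ^ m) := by
    intro x hx
    have : 0 ≤ x := ha.trans (le_of_lt hx)
    positivity
  have hlim : Tendsto (fun r : ℝ => -Real.exp (-(r / √2) ^ m)) atTop (𝓝 0) := by
    rw [← neg_zero]
    refine (Real.tendsto_exp_neg_atTop_nhds_zero.comp ?_).neg
    exact (tendsto_pow_atTop hm.ne').comp (tendsto_id.atTop_div_const (by positivity))
  have h1 := integral_Ioi_of_hasDerivAt_of_nonneg' hderiv hpos hlim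
  have h2 := integrableOn_Ioi_deriv_of_nonneg' hderiv hpos hlim
  rw [radialLaw, withDensity_apply _ measurableSet_Ioi, Measure.restrict_restrict measurableSet_Ioi,
    Set.inter_eq_left.2 (Set.Ioi_subset_Ioi ha), ← ofReal_integral_eq_lintegral_ofReal h2
      ((ae_restrict_iff' measurableSet_Ioi).2 (ae_of_all _ hpos)), h1]
  simp

theorem isProbabilityMeasure_radialLaw {m : ℕ} (hm : 0 < m) :
    IsProbabilityMeasure (radialLaw m) := by
  have h0 : radialLaw m (Set.Iic 0) = 0 := by
    rw [radialLaw]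
    refine withDensity_absolutelyContinuous _ _ ?_
    rw [Measure.restrict_apply measurableSet_Iic, Set.Iic_inter_Ioi, Set.Ioc_self, measure_empty]
  have h1 : radialLaw m (Set.Ioi 0) = 1 := by
    rw [radialLaw_Ioi hm le_rfl]; simp [hm.ne']
  refine ⟨le_antisymm ?_ (h1 ▸ measure_mono (Set.subset_univ _))⟩
  calc radialLaw m Set.univ ≤ radialLaw m (Set.Iic 0 ∪ Set.Ioi 0) :=
        measure_mono (by simp)
    _ ≤ radialLaw m (Set.Iic 0) + radialLaw m (Set.Ioi 0) := measure_union_le _ _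
    _ = 1 := by rw [h0, h1, zero_add]

theorem radialLaw_Ioi_of_nonpos {m : ℕ} (hm : 0 < m) {a : ℝ} (ha : a ≤ 0) :
    radialLaw m (Set.Ioi a) = 1 := by
  have := isProbabilityMeasure_radialLaw hm
  refine le_antisymm prob_le_one ?_
  calc (1 : ENNReal) = radialLaw m (Set.Ioi 0) := by
        rw [radialLaw_Ioi hm le_rfl]; simp [hm.ne']
    _ ≤ _ := measure_mono (Set.Ioi_subset_Ioi ha)

/-- For `a ≥ 0` the event `√(2R) > a` is `R > a ^ 2 / 2`, and `(a ^ 2 / 2) ^ (m / 2) = (a / √2) ^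
m`. Agreement of tails determines the law. -/
theorem map_sqrt_eq_radialLaw {m : ℕ} (hm : 0 < m) {Ω : Type*} [MeasurableSpace Ω] {P : Measure Ω}
    [IsProbabilityMeasure P] {R : Ω → ℝ} (hR : IsWeibull P (2 / m) R) :
    P.map (fun ω => √(2 * R ω)) = radialLaw m := by
  have hmeas : Measurable fun ω => √(2 * R ω) := (hR.measurable.const_mul 2).sqrt
  have : IsProbabilityMeasure (radialLaw m) := isProbabilityMeasure_radialLaw hm
  have : IsProbabilityMeasure (P.map fun ω => √(2 * R ω)) :=
    Measure.isProbabilityMeasure_map hmeas.aemeasurable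
  refine Measure.ext_of_Iic _ _ fun a => ?_
  rw [← Set.compl_Ioi, prob_compl_eq_one_sub measurableSet_Ioi,
    prob_compl_eq_one_sub measurableSet_Ioi, Measure.map_apply hmeas measurableSet_Ioi]
  congr 1
  rcases lt_or_ge a 0 with ha | ha
  · rw [radialLaw_Ioi_of_nonpos hm ha.le]
    have : (fun ω => √(2 * R ω)) ⁻¹' Set.Ioi a = Set.univ := by
      ext ω
      simpa using ha.trans_le (Real.sqrt_nonneg (2 * R ω))
    rw [this, measure_univ]
  · rw [radialLaw_Ioi hm ha]
    have : (fun ω => √(2 * R ω)) ⁻¹' Set.Ioi a = {ω | a ^ 2 / 2 < R ω} := by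
      ext ω
      simp only [Set.mem_preimage, Set.mem_Ioi, Set.mem_ofPred_eq, Real.lt_sqrt ha]
      constructor <;> intro h <;> linarith
    rw [this, ← ofReal_measureReal, hR.tail _ (by positivity)]
    congr 3
    have : a ^ 2 / 2 = (a / √2) ^ 2 := by rw [div_pow, Real.sq_sqrt (by norm_num)]
    rw [this, one_div_div, ← Real.rpow_natCast _ 2, ← Real.rpow_mul (by positivity),
      ← Real.rpow_natCast]
    congr 1
    push_cast
    ring

/-- Polar coordinates for Lebesgue integrals. -/
theorem lintegral_polar {T : Type*} [NormedAddCommGroup T] [InnerProductSpace ℝ T]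
    [FiniteDimensional ℝ T] [MeasurableSpace T] [BorelSpace T] [Nontrivial T] {G : T → ENNReal}
    (hG : Measurable G) :
    ∫⁻ u, G u = ∫⁻ θ : Metric.sphere (0 : T) 1, (∫⁻ r in Set.Ioi (0 : ℝ),
      ENNReal.ofReal (r ^ (Module.finrank ℝ T - 1)) * G (r • (θ : T)))
        ∂(volume : Measure T).toSphere := by
  have h0 : MeasurableSet ({0}ᶜ : Set T) := (measurableSet_singleton _).compl
  have hmp := (volume : Measure T).measurePreserving_homeomorphUnitSphereProd
  have hG' : Measurable fun p : Metric.sphere (0 : T) 1 × Set.Ioi (0 : ℝ) =>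
      G ((p.2 : ℝ) • (p.1 : T)) := by fun_prop
  calc ∫⁻ u, G u = ∫⁻ u in ({0}ᶜ : Set T), G u := by rw [restrict_compl_singleton]
    _ = ∫⁻ u : ({0}ᶜ : Set T), G u ∂(Measure.comap Subtype.val volume) :=
        (lintegral_subtype_comap h0 _).symm
    _ = ∫⁻ u : ({0}ᶜ : Set T), G (((homeomorphUnitSphereProd T u).2 : ℝ) •
          ((homeomorphUnitSphereProd T u).1 : T)) ∂(Measure.comap Subtype.val volume) := by
        refine lintegral_congr fun u => ?_
        congr 1
        have := congrArg Subtype.val ((homeomorphUnitSphereProd T).symm_apply_apply u)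
        rw [homeomorphUnitSphereProd_symm_apply_coe] at this
        exact this.symm
    _ = ∫⁻ p, G ((p.2 : ℝ) • (p.1 : T)) ∂((volume : Measure T).toSphere.prod
          (Measure.volumeIoiPow (Module.finrank ℝ T - 1))) := hmp.lintegral_comp hG'
    _ = ∫⁻ θ, ∫⁻ r, G ((r : ℝ) • (θ : T))
          ∂(Measure.volumeIoiPow (Module.finrank ℝ T - 1))
          ∂(volume : Measure T).toSphere := lintegral_prod _ hG'.aemeasurable
    _ = _ := by
        refine lintegral_congr fun θ => ?_
        rw [Measure.volumeIoiPow, lintegral_withDensity_eq_lintegral_mul _ (by fun_prop)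
          (by fun_prop)]
        exact lintegral_subtype_comap measurableSet_Ioi
          fun r : ℝ => ENNReal.ofReal (r ^ (Module.finrank ℝ T - 1)) * G (r • (θ : T))

/-- The density of `√(2 R) Θ` for a Weibull radius and an independent uniform direction. -/
theorem map_smul_eq_withDensity {T : Type*} [NormedAddCommGroup T] [InnerProductSpace ℝ T]
    [FiniteDimensional ℝ T] [MeasurableSpace T] [BorelSpace T] [Nontrivial T]
    {Ω : Type*} [MeasurableSpace Ω] {P : Measure Ω} [IsProbabilityMeasure P] {R : Ω → ℝ}
    (hR : IsWeibull P (2 / Module.finrank ℝ T) R) {Θ : Ω → Metric.sphere (0 : T) 1}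
    (hΘm : Measurable Θ)
    (hΘ : P.map Θ = ((volume : Measure T).toSphere Set.univ)⁻¹ • (volume : Measure T).toSphere)
    (hind : IndepFun R Θ P) :
    P.map (fun ω => √(2 * R ω) • (Θ ω : T)) = volume.withDensity fun u =>
      ENNReal.ofReal ((volume.real (Metric.ball (0 : T) 1) * √2 ^ Module.finrank ℝ T)⁻¹ *
        Real.exp (-(‖u‖ / √2) ^ Module.finrank ℝ T)) := by
  set m := Module.finrank ℝ T
  have hm : 0 < m := Module.finrank_pos
  set ω₁ := volume.real (Metric.ball (0 : T) 1) with hω₁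
  have hω : 0 < ω₁ := ENNReal.toReal_pos (Metric.measure_ball_pos _ _ one_pos).ne'
    measure_ball_lt_top.ne
  -- Normalising the sphere by its mass `m * ω₁` cancels the `m` in the radial density. What remains
  -- is `r ^ (m - 1)`, the polar Jacobian, times the stated density.
  have hσ : (volume : Measure T).toSphere Set.univ = ENNReal.ofReal (m * ω₁) := by
    rw [← ofReal_measureReal, Measure.toSphere_real_apply_univ]
  have hSm : Measurable fun ω => √(2 * R ω) := (hR.measurable.const_mul 2).sqrt
  have hpair : P.map (fun ω => (√(2 * R ω), Θ ω)) = (radialLaw m).prod (P.map Θ) := by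
    rw [← map_sqrt_eq_radialLaw hm hR]
    refine (indepFun_iff_map_prod_eq_prod_map_map hSm.aemeasurable hΘm.aemeasurable).1 ?_
    exact hind.comp (φ := fun r : ℝ => √(2 * r)) (ψ := id) (by fun_prop) measurable_id
  have : IsProbabilityMeasure (radialLaw m) := isProbabilityMeasure_radialLaw hm
  have : IsProbabilityMeasure (P.map Θ) := Measure.isProbabilityMeasure_map hΘm.aemeasurable
  refine Measure.ext_of_lintegral _ fun G hG => ?_
  have hsm : Measurable fun p : ℝ × Metric.sphere (0 : T) 1 => p.1 • (p.2 : T) := by fun_prop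
  have hlhs : ∫⁻ u, G u ∂(P.map fun ω => √(2 * R ω) • (Θ ω : T)) =
      ∫⁻ θ, ∫⁻ r, G (r • (θ : T)) ∂(radialLaw m) ∂(P.map Θ) := by
    calc _ = ∫⁻ ω, G (√(2 * R ω) • (Θ ω : T)) ∂P :=
          lintegral_map hG (hsm.comp (hSm.prodMk hΘm))
      _ = ∫⁻ p, G (p.1 • (p.2 : T)) ∂(P.map fun ω => (√(2 * R ω), Θ ω)) :=
          (lintegral_map (hG.comp hsm) (hSm.prodMk hΘm)).symm
      _ = _ := by
          rw [hpair]
          exact lintegral_prod_symm _ (hG.comp hsm).aemeasurable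
  have hexp : Measurable fun u : T => ENNReal.ofReal ((ω₁ * √2 ^ m)⁻¹ *
      Real.exp (-(‖u‖ / √2) ^ m)) := by fun_prop
  rw [hlhs, lintegral_withDensity_eq_lintegral_mul _ hexp hG, lintegral_polar (hexp.mul hG), hΘ,
    lintegral_smul_measure, hσ, smul_eq_mul, ← ENNReal.ofReal_inv_of_pos (by positivity),
    ← lintegral_const_mul' _ _ ENNReal.ofReal_ne_top]
  refine lintegral_congr fun θ => ?_
  have hGθ : Measurable fun r : ℝ => G (r • (θ : T)) := by fun_prop
  rw [radialLaw, lintegral_withDensity_eq_lintegral_mul _ (by fun_prop) hGθ,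
    ← lintegral_const_mul' _ _ ENNReal.ofReal_ne_top]
  refine setLIntegral_congr_fun measurableSet_Ioi fun r hr => ?_
  have hr0 : 0 < r := hr
  simp only [Pi.mul_apply]
  rw [← mul_assoc, ← mul_assoc, ← ENNReal.ofReal_mul (by positivity),
    ← ENNReal.ofReal_mul (by positivity), norm_smul, norm_eq_of_mem_sphere, mul_one,
    Real.norm_eq_abs, abs_of_pos hr0]
  congr 2
  have : (m : ℝ) ≠ 0 := by positivity
  field_simp
  rfl

/-! ### Limit theorem for the attention shift -/

theorem exists_gnomonicModel {d : ℕ} (hd : 2 ≤ d) (q : UnitSphere d) {ρ : UnitSphere d → ℝ}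
    (hρ0 : ∀ x, 0 ≤ ρ x) (hρq : 0 < ρ q) (hρ : Continuous ρ) :
    ∃ h : TangentAt q → ℝ,
      IsGnomonicModel (contextLaw ρ) (queryDepth q) (gnomonicChart q) h ∧ 0 < h 0 := by
  obtain ⟨c, hc, hcσ⟩ := exists_surfaceMeasure_gnomonic hd q
  have hγ := continuous_gnomonicChart q
  have hw : Continuous fun v : TangentAt q => c * (√(1 + ‖v‖ ^ 2))⁻¹ ^ d := by
    have h : Continuous fun v : TangentAt q => (√(1 + ‖v‖ ^ 2))⁻¹ :=
      Continuous.inv₀ (by fun_prop) fun v => by positivity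
    fun_prop
  refine ⟨fun v => c * (√(1 + ‖v‖ ^ 2))⁻¹ ^ d * ρ (gnomonicChart q v),
    ⟨measurable_queryDepth q, queryDepth_nonneg q, hγ.measurable, depth_gnomonicChart q,
      hw.mul (hρ.comp hγ), fun v => mul_nonneg (by positivity) (hρ0 _), ?_⟩, ?_⟩
  · have hH : MeasurableSet {x : UnitSphere d | queryDepth q x < 1} :=
      measurableSet_lt (measurable_queryDepth q) measurable_const
    have hρm : Measurable fun x => ENNReal.ofReal (ρ x) := hρ.measurable.ennreal_ofReal
    have hcσ' : (surfaceMeasure d).restrict {x | queryDepth q x < 1} = _ := hcσ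
    rw [contextLaw, restrict_withDensity hH, hcσ']
    ext A hA
    rw [withDensity_apply _ hA, setLIntegral_map hA hρm hγ.measurable,
      Measure.map_apply hγ.measurable hA, withDensity_apply _ (hγ.measurable hA),
      show (fun v => ENNReal.ofReal (ρ (gnomonicChart q v))) =
        (fun x => ENNReal.ofReal (ρ x)) ∘ gnomonicChart q from rfl,
      setLIntegral_withDensity_eq_setLIntegral_mul _ hw.measurable.ennreal_ofReal
        (hρm.comp hγ.measurable) (hγ.measurable hA)]
    refine lintegral_congr fun v => ?_
    exact (ENNReal.ofReal_mul (by positivity)).symm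
  · simpa [gnomonicChart_zero] using mul_pos hc hρq

/-- The gnomonic chart is tangent to the inclusion of the tangent space. -/
theorem tendsto_smul_gnomonicChart_sub {d : ℕ} (q : UnitSphere d) {s : ℕ → ℝ}
    (hs : Tendsto s atTop atTop) (u : TangentAt q) :
    Tendsto (fun n => s n • ((gnomonicChart q ((s n)⁻¹ • u) : EuclideanSpace ℝ (Fin d)) - q)) atTop
      (𝓝 (u : EuclideanSpace ℝ (Fin d))) := by
  have h0 : Tendsto (fun n => (s n)⁻¹ * ‖u‖) atTop (𝓝 0) := by
    simpa using hs.inv_tendsto_atTop.mul_const ‖u‖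
  have hψ : Tendsto (fun n => gnomonicDepth ((s n)⁻¹ * ‖u‖)) atTop (𝓝 0) := by
    simpa [gnomonicDepth_zero, Function.comp_def] using (continuous_gnomonicDepth.tendsto 0).comp h0
  -- With `δ` the depth, the scaled displacement equals `(1 - δ) • u - (s n * δ) • q`. The component
  -- along `q` is of second order, since `s n ^ 2 * δ` converges.
  have h1 : Tendsto (fun n => s n * gnomonicDepth ((s n)⁻¹ * ‖u‖)) atTop (𝓝 0) := by
    have := (tendsto_sq_mul_gnomonicDepth hs ‖u‖).mul hs.inv_tendsto_atTop
    rw [mul_zero] at this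
    refine this.congr' ?_
    filter_upwards [hs.eventually_gt_atTop 0] with n hn
    rw [Pi.inv_apply]
    field_simp
  have h2 : Tendsto (fun n => (1 - gnomonicDepth ((s n)⁻¹ * ‖u‖)) • (u : EuclideanSpace ℝ (Fin d)) -
      (s n * gnomonicDepth ((s n)⁻¹ * ‖u‖)) • (q : EuclideanSpace ℝ (Fin d))) atTop
      (𝓝 ((1 - (0 : ℝ)) • (u : EuclideanSpace ℝ (Fin d)) -
        (0 : ℝ) • (q : EuclideanSpace ℝ (Fin d)))) :=
    ((hψ.const_sub 1).smul_const _).sub (h1.smul_const _)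
  rw [sub_zero, one_smul, zero_smul, sub_zero] at h2
  refine h2.congr' ?_
  filter_upwards [hs.eventually_gt_atTop 0] with n hn
  have h3 : ‖(s n)⁻¹ • u‖ = (s n)⁻¹ * ‖u‖ := by
    rw [norm_smul, norm_inv, Real.norm_eq_abs, abs_of_pos hn]
  have h4 : (√(1 + ((s n)⁻¹ * ‖u‖) ^ 2))⁻¹ = 1 - gnomonicDepth ((s n)⁻¹ * ‖u‖) := by
    rw [gnomonicDepth]; ring
  rw [coe_gnomonicChart, h3, h4, Submodule.coe_smul]
  generalize gnomonicDepth ((s n)⁻¹ * ‖u‖) = δ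
  rw [smul_sub, smul_smul, smul_add, smul_smul, mul_right_comm, mul_inv_cancel₀ hn.ne', one_mul]
  module

theorem tendsto_exp_neg_natCast_div_pow {m : ℕ} (hm : m ≠ 0) {c : ℝ} (hc : 0 < c) :
    Tendsto (fun N : ℕ => Real.exp (-((N : ℝ) / c) ^ m)) atTop (𝓝 0) :=
  Real.tendsto_exp_neg_atTop_nhds_zero.comp
    ((tendsto_pow_atTop hm).comp (tendsto_natCast_atTop_atTop.atTop_div_const hc))

/-- The centred attention sum `∑ j, A j • x j - q`. -/
noncomputable def attentionShift {d n : ℕ} (β : ℝ) (q : UnitSphere d) (x : Fin n → UnitSphere d) :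
    EuclideanSpace ℝ (Fin d) :=
  ∑ j, attentionWeight β q x j • (x j : EuclideanSpace ℝ (Fin d)) - q

section Limit

variable {d : ℕ} {Ω : Type*} [MeasurableSpace Ω] {P : Measure Ω}
  [IsProbabilityMeasure P] {q : UnitSphere d} {X : ℕ → Ω → UnitSphere d}
  {μ : Measure (UnitSphere d)} [IsProbabilityMeasure μ] {h : TangentAt q → ℝ}
  {s β : ℕ → ℝ}

theorem measurable_attentionShift (hXm : ∀ i, Measurable (X i)) (n : ℕ) (b : ℝ) :
    Measurable fun ω => attentionShift b q (fun j : Fin n => X j ω) :=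
  ((measurable_attentionSum b q).sub_const _).comp (measurable_pi_lambda _ fun j => hXm j)

/-- The expectation of a test function of the rescaled attention shift is eventually close to the
corresponding truncated integral against the limit density. -/
theorem eventually_abs_integral_sub_le [Nontrivial (TangentAt q)]
    (H : IsGnomonicModel μ (queryDepth q) (gnomonicChart q) h) (h0 : 0 < h 0)
    (hXm : ∀ i, Measurable (X i)) (hXi : iIndepFun X P) (hXl : ∀ i, P.map (X i) = μ)
    (hs : Tendsto s atTop atTop)
    (hsn : ∀ n : ℕ, s n ^ Module.finrank ℝ (TangentAt q) = IsGnomonicModel.intensity h * n)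
    (hβ : Tendsto (fun n => β n / s n ^ 2) atTop atTop)
    {f : EuclideanSpace ℝ (Fin d) → ℝ} {M : ℝ} (hM : ∀ z, |f z| ≤ M) {K : NNReal}
    (hK : LipschitzWith K f) {L : ℝ} (hL : 0 ≤ L) {ε : ℝ} (hε : 0 < ε) :
    ∀ᶠ n : ℕ in atTop, |∫ ω, f (s n • attentionShift (β n) q (fun j : Fin n => X j ω)) ∂P -
      h 0 / IsGnomonicModel.intensity h * ∫ u in Metric.closedBall (0 : TangentAt q) L,
        f u * Real.exp (-(‖u‖ / √2) ^ Module.finrank ℝ (TangentAt q))| ≤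
      M * Real.exp (-(L / √2) ^ Module.finrank ℝ (TangentAt q)) + ε := by
  have hM0 : 0 ≤ M := (abs_nonneg _).trans (hM 0)
  have h1 := H.tendsto_nearest_term h0 hs hsn hL
    (g := fun n x => f (s n • ((x : EuclideanSpace ℝ (Fin d)) - q)))
    (fun n => hK.continuous.measurable.comp (by fun_prop)) (fun n x => hM _)
    (φ := fun u => f u)
    (fun u => (hK.continuous.tendsto _).comp (tendsto_smul_gnomonicChart_sub q hs u))
  have h2 := (H.tendsto_depth_gt_pow h0 hs hsn hL).const_mul M
  have h3 := H.tendsto_pair_term h0 hs hsn hβ (L := L) hM0 (B := 3 * K) (by positivity)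
  have h4 := h2.add h3
  rw [add_zero] at h4
  filter_upwards [h4.eventually_lt_const (lt_add_of_pos_right _ (half_pos hε)),
    Metric.tendsto_nhds.1 h1 (ε / 2) (half_pos hε), hs.eventually_gt_atTop 0,
    hβ.eventually_ge_atTop 1, eventually_gt_atTop 0] with n hn1 hn2 hn3 hn4 hn5
  have h5 := abs_integral_sub_nearest_le (q := q) hXm hXi hXl hM hK hn5 hn3
    ((one_le_div (by positivity)).1 hn4) L
  rw [Real.dist_eq] at hn2
  refine (abs_sub_le _ _ _).trans ((add_le_add h5 hn2.le).trans ?_)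
  linarith

/-- The truncation radius `L = N` is fixed first so that both the empty-cap term and the tail of the
limit integral are small; only then is `n` taken large. -/
theorem tendsto_integral_attentionShift [Nontrivial (TangentAt q)]
    (H : IsGnomonicModel μ (queryDepth q) (gnomonicChart q) h) (h0 : 0 < h 0)
    (hXm : ∀ i, Measurable (X i)) (hXi : iIndepFun X P) (hXl : ∀ i, P.map (X i) = μ)
    (hs : Tendsto s atTop atTop)
    (hsn : ∀ n : ℕ, s n ^ Module.finrank ℝ (TangentAt q) = IsGnomonicModel.intensity h * n)
    (hβ : Tendsto (fun n => β n / s n ^ 2) atTop atTop)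
    (hint : Integrable fun u : TangentAt q =>
      Real.exp (-(‖u‖ / √2) ^ Module.finrank ℝ (TangentAt q)))
    {f : EuclideanSpace ℝ (Fin d) → ℝ} {M : ℝ} (hM : ∀ z, |f z| ≤ M) {K : NNReal}
    (hK : LipschitzWith K f) :
    Tendsto (fun n : ℕ => ∫ ω, f (s n • attentionShift (β n) q (fun j : Fin n => X j ω)) ∂P) atTop
      (𝓝 (h 0 / IsGnomonicModel.intensity h * ∫ u : TangentAt q,
        f u * Real.exp (-(‖u‖ / √2) ^ Module.finrank ℝ (TangentAt q)))) := by
  set m := Module.finrank ℝ (TangentAt q)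
  have hm : m ≠ 0 := Module.finrank_pos.ne'
  have hfint : Integrable fun u : TangentAt q => f u * Real.exp (-(‖u‖ / √2) ^ m) :=
    hint.bdd_mul (c := M) (hK.continuous.comp continuous_subtype_val).aestronglyMeasurable
      (ae_of_all _ fun u => hM _)
  have h1 : Tendsto (fun N : ℕ => h 0 / IsGnomonicModel.intensity h *
      ∫ u in Metric.closedBall (0 : TangentAt q) N, f u * Real.exp (-(‖u‖ / √2) ^ m)) atTop
      (𝓝 (h 0 / IsGnomonicModel.intensity h *
        ∫ u : TangentAt q, f u * Real.exp (-(‖u‖ / √2) ^ m))) := by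
    have := tendsto_setIntegral_of_monotone (μ := volume)
      (s := fun N : ℕ => Metric.closedBall (0 : TangentAt q) N)
      (fun N => Metric.isClosed_closedBall.measurableSet)
      (fun a b hab => Metric.closedBall_subset_closedBall (by exact_mod_cast hab))
      hfint.integrableOn
    rw [Metric.iUnion_closedBall_nat, setIntegral_univ] at this
    exact this.const_mul _
  have h2 : Tendsto (fun N : ℕ => M * Real.exp (-((N : ℝ) / √2) ^ m)) atTop (𝓝 0) := by
    simpa using (tendsto_exp_neg_natCast_div_pow hm (show 0 < √2 by positivity)).const_mul M
  refine Metric.tendsto_nhds.2 fun ε hε => ?_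
  obtain ⟨N, hN1, hN2⟩ := ((Metric.tendsto_nhds.1 h1 (ε / 3) (by positivity)).and
    (h2.eventually_lt_const (show 0 < ε / 3 by positivity))).exists
  filter_upwards [eventually_abs_integral_sub_le H h0 hXm hXi hXl hs hsn hβ hM hK N.cast_nonneg
    (show 0 < ε / 4 by positivity)] with n hn
  rw [Real.dist_eq] at hN1 ⊢
  refine (abs_sub_le _ _ _).trans_lt ((add_le_add hn hN1.le).trans_lt ?_)
  linarith

/-- The attention shift tends to zero in probability. -/
theorem tendstoInMeasure_attentionShift [Nontrivial (TangentAt q)]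
    (H : IsGnomonicModel μ (queryDepth q) (gnomonicChart q) h) (h0 : 0 < h 0)
    (hXm : ∀ i, Measurable (X i)) (hXi : iIndepFun X P) (hXl : ∀ i, P.map (X i) = μ)
    (hs : Tendsto s atTop atTop)
    (hsn : ∀ n : ℕ, s n ^ Module.finrank ℝ (TangentAt q) = IsGnomonicModel.intensity h * n)
    (hβ : Tendsto (fun n => β n / s n ^ 2) atTop atTop) :
    TendstoInMeasure P (fun (n : ℕ) ω => attentionShift (β n) q (fun j : Fin n => X j ω)) atTop
      (fun _ => 0) := by
  set m := Module.finrank ℝ (TangentAt q)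
  have hm : m ≠ 0 := Module.finrank_pos.ne'
  rw [tendstoInMeasure_iff_measureReal_norm]
  intro ε hε
  have h2 : Tendsto (fun N : ℕ => 1 * Real.exp (-((N : ℝ) / √2) ^ m)) atTop (𝓝 0) := by
    simpa using tendsto_exp_neg_natCast_div_pow hm (show 0 < √2 by positivity)
  refine Metric.tendsto_nhds.2 fun η hη => ?_
  obtain ⟨N, hN⟩ := (h2.eventually_lt_const (show 0 < η / 2 by positivity)).exists
  -- This cutoff vanishes on the ball of radius `N`, killing the limiting main term, and equals `1`
  -- beyond radius `N + 1`. It yields tightness of the scaled shift without a realisation of the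
  -- limit variables; dividing by `s n → ∞` then gives convergence to zero.
  let f : EuclideanSpace ℝ (Fin d) → ℝ := fun z => min 1 (max 0 (‖z‖ - N))
  have hf0 : ∀ z, 0 ≤ f z := fun z => le_min zero_le_one (le_max_left _ _)
  have hM : ∀ z, |f z| ≤ 1 := fun z => by
    rw [abs_of_nonneg (hf0 z)]; exact min_le_left _ _
  have hK : LipschitzWith 1 f := by
    refine LipschitzWith.const_min (LipschitzWith.const_max ?_ 0) 1
    refine LipschitzWith.of_dist_le_mul fun x y => ?_
    simpa using lipschitzWith_one_norm.dist_le_mul x y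
  have hzero : ∫ u in Metric.closedBall (0 : TangentAt q) N, f u * Real.exp (-(‖u‖ / √2) ^ m) =
      0 := by
    refine (setIntegral_congr_fun Metric.isClosed_closedBall.measurableSet fun u hu => ?_).trans
      (integral_zero _ _)
    have hu' : ‖(u : EuclideanSpace ℝ (Fin d))‖ ≤ N := by simpa using hu
    have : f u = 0 := by
      simp only [f]
      rw [max_eq_left (by linarith), min_eq_right zero_le_one]
    simp [this]
  filter_upwards [eventually_abs_integral_sub_le H h0 hXm hXi hXl hs hsn hβ hM hK N.cast_nonneg
    (show 0 < η / 4 by positivity), hs.eventually_ge_atTop ((N + 1) / ε),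
    hs.eventually_gt_atTop 0] with n hn hsn' hsn0
  rw [hzero, mul_zero, sub_zero] at hn
  have hZm := (measurable_attentionShift (q := q) hXm n (β n)).const_smul (s n)
  have hle : P.real {ω | ε ≤ ‖attentionShift (β n) q (fun j : Fin n => X j ω) - 0‖} ≤
      ∫ ω, f (s n • attentionShift (β n) q (fun j : Fin n => X j ω)) ∂P := by
    have hA : MeasurableSet {ω | ε ≤ ‖attentionShift (β n) q (fun j : Fin n => X j ω) - 0‖} :=
      measurableSet_le measurable_const
        ((measurable_attentionShift (q := q) hXm n (β n)).sub_const _).norm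
    rw [← integral_indicator_one hA]
    refine integral_mono ((integrable_const 1).indicator hA)
      (Integrable.of_bound (hK.continuous.measurable.comp hZm).aestronglyMeasurable 1
        (ae_of_all _ fun ω => hM _)) fun ω => ?_
    by_cases hω : ε ≤ ‖attentionShift (β n) q (fun j : Fin n => X j ω) - 0‖
    · rw [Set.indicator_of_mem (by exact hω), Pi.one_apply]
      refine le_min le_rfl (le_max_of_le_right ?_)
      rw [sub_zero] at hω
      rw [norm_smul, Real.norm_eq_abs, abs_of_pos hsn0]
      have h3 : (N + 1) / ε * ε ≤ s n * ‖attentionShift (β n) q (fun j : Fin n => X j ω)‖ := by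
        gcongr
      rw [div_mul_cancel₀ _ hε.ne'] at h3
      linarith
    · rw [Set.indicator_of_notMem (by exact hω)]
      exact hf0 _
  rw [Real.dist_eq, sub_zero, abs_of_nonneg measureReal_nonneg]
  have := (le_abs_self _).trans hn
  linarith

end Limit

/-! ### Transfer to the displacement and the theorem -/

theorem attentionDisplacement_eq {d n : ℕ} (V : Matrix (Fin d) (Fin d) ℝ) (β : ℝ)
    (q : UnitSphere d) (x : Fin n → UnitSphere d) :
    attentionDisplacement V β q x = Matrix.toEuclideanCLM (𝕜 := ℝ) V (attentionShift β q x) := by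
  rw [attentionDisplacement, attentionOutput, attentionShift, map_sub]

theorem alphaExp_eq {d : ℕ} (hd : 2 ≤ d) (q : UnitSphere d) :
    alphaExp d = 2 / (Module.finrank ℝ (TangentAt q) : ℝ) := by
  rw [finrank_tangentAt hd, alphaExp, Nat.cast_sub (by omega)]
  simp

theorem sqrt_rpow_alphaExp_pow {m : ℕ} (hm : 0 < m) {x : ℝ} (hx : 0 ≤ x) :
    √(x ^ (2 / (m : ℝ))) ^ m = x := by
  rw [Real.sqrt_eq_rpow, ← Real.rpow_mul hx, ← Real.rpow_natCast, ← Real.rpow_mul hx]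
  have : (m : ℝ) ≠ 0 := by positivity
  have h : 2 / (m : ℝ) * (1 / 2) * m = 1 := by field_simp
  rw [h, Real.rpow_one]

theorem IsIIDSphericalContext.isProbabilityMeasure {d : ℕ} {hd : 2 ≤ d} {Ω : Type*}
    [MeasurableSpace Ω] {P : Measure Ω} [IsProbabilityMeasure P] {q : UnitSphere d}
    {ρ : UnitSphere d → ℝ} {X : ℕ → Ω → UnitSphere d} (hX : IsIIDSphericalContext hd P q ρ X) :
    IsProbabilityMeasure (contextLaw ρ) :=
  hX.law 0 ▸ Measure.isProbabilityMeasure_map (hX.measurable 0).aemeasurable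

/-- Convergence in distribution of the rescaled attention shift. -/
theorem tendstoInDistribution_attentionShift {d : ℕ} {q : UnitSphere d} {Ω : Type*}
    [MeasurableSpace Ω] {P : Measure Ω} [IsProbabilityMeasure P] {X : ℕ → Ω → UnitSphere d}
    {μ : Measure (UnitSphere d)} [IsProbabilityMeasure μ] {h : TangentAt q → ℝ} {s β : ℕ → ℝ}
    [Nontrivial (TangentAt q)]
    (H : IsGnomonicModel μ (queryDepth q) (gnomonicChart q) h) (h0 : 0 < h 0)
    (hXm : ∀ i, Measurable (X i)) (hXi : iIndepFun X P) (hXl : ∀ i, P.map (X i) = μ)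
    (hs : Tendsto s atTop atTop)
    (hsn : ∀ n : ℕ, s n ^ Module.finrank ℝ (TangentAt q) = IsGnomonicModel.intensity h * n)
    (hβ : Tendsto (fun n => β n / s n ^ 2) atTop atTop)
    {Ω' : Type*} [MeasurableSpace Ω'] {P' : Measure Ω'} [IsProbabilityMeasure P'] {R : Ω' → ℝ}
    {Θ : Ω' → TangentSphere q} (hR : IsWeibull P' (2 / Module.finrank ℝ (TangentAt q)) R)
    (hΘm : Measurable Θ) (hΘ : P'.map Θ = tangentUniform q) (hind : IndepFun R Θ P') :
    TendstoInDistribution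
      (fun (n : ℕ) ω => s n • attentionShift (β n) q (fun j : Fin n => X j ω)) atTop
      (fun ω' => √(2 * R ω') • ((Θ ω' : TangentAt q) : EuclideanSpace ℝ (Fin d)))
      (fun _ => P) P' := by
  set m := Module.finrank ℝ (TangentAt q)
  set w : TangentAt q → ℝ := fun u => Real.exp (-(‖u‖ / √2) ^ m)
  set κ : ℝ := (volume.real (Metric.ball (0 : TangentAt q) 1) * √2 ^ m)⁻¹
  have hκ : 0 < κ := by
    have : 0 < volume.real (Metric.ball (0 : TangentAt q) 1) :=
      ENNReal.toReal_pos (Metric.measure_ball_pos _ _ one_pos).ne' measure_ball_lt_top.ne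
    positivity
  have hκ' : h 0 / IsGnomonicModel.intensity h = κ := by
    rw [IsGnomonicModel.intensity, mul_assoc, div_mul_cancel_left₀ h0.ne']
  have hZm : ∀ n : ℕ, Measurable fun ω =>
      s n • attentionShift (β n) q (fun j : Fin n => X j ω) := fun n =>
    (measurable_attentionShift hXm n (β n)).const_smul (s n)
  have hTm : Measurable fun ω' => √(2 * R ω') • (Θ ω' : TangentAt q) :=
    (hR.measurable.const_mul 2).sqrt.smul (measurable_subtype_coe.comp hΘm)
  have hlaw : P'.map (fun ω' => √(2 * R ω') • (Θ ω' : TangentAt q)) =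
      volume.withDensity fun u => ENNReal.ofReal (κ * w u) :=
    map_smul_eq_withDensity hR hΘm hΘ hind
  have hwm : Measurable w := by fun_prop
  have hw0 : ∀ u, 0 ≤ κ * w u := fun u => by positivity
  -- Integrability is read off from the total mass `1` of the law of the limit variable.
  have hwi : Integrable w := by
    have h1 : ∫⁻ u, ENNReal.ofReal (κ * w u) = 1 := by
      rw [← setLIntegral_univ, ← withDensity_apply _ .univ, ← hlaw]
      have := Measure.isProbabilityMeasure_map (μ := P') hTm.aemeasurable
      exact measure_univ
    have h2 : Integrable fun u => κ * w u := by
      refine (lintegral_ofReal_ne_top_iff_integrable (hwm.const_mul κ).aestronglyMeasurable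
        (ae_of_all _ hw0)).1 ?_
      rw [h1]; exact ENNReal.one_ne_top
    simpa [hκ.ne'] using h2.const_mul κ⁻¹
  have hlim : Measurable fun ω' => √(2 * R ω') • ((Θ ω' : TangentAt q) :
      EuclideanSpace ℝ (Fin d)) := measurable_subtype_coe.comp hTm
  refine ⟨fun n => (hZm n).aemeasurable, hlim.aemeasurable, ?_⟩
  -- Bounded Lipschitz functions suffice for weak convergence. Boundedness is given here as a bound
  -- `D` on oscillation, hence the sup bound `D + |f 0|`.
  refine tendsto_iff_forall_lipschitz_integral_tendsto.2 fun f ⟨D, hD⟩ ⟨K, hK⟩ => ?_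
  have hM : ∀ z, |f z| ≤ D + |f 0| := fun z => by
    have h1 := hD z 0
    rw [Real.dist_eq] at h1
    have h2 := abs_sub_abs_le_abs_sub (f z) (f 0)
    linarith
  have hmain := tendsto_integral_attentionShift H h0 hXm hXi hXl hs hsn hβ hwi hM hK
  have hfm : Measurable f := hK.continuous.measurable
  have hval : ∫ z, f z ∂(P'.map fun ω' => √(2 * R ω') • ((Θ ω' : TangentAt q) :
      EuclideanSpace ℝ (Fin d))) =
      h 0 / IsGnomonicModel.intensity h * ∫ u : TangentAt q, f u * w u := by
    calc _ = ∫ ω', f ((√(2 * R ω') • (Θ ω' : TangentAt q) : TangentAt q)) ∂P' :=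
          integral_map hlim.aemeasurable hfm.aestronglyMeasurable
      _ = ∫ u : TangentAt q, f u
            ∂(P'.map (fun ω' => √(2 * R ω') • (Θ ω' : TangentAt q))) :=
          (integral_map (f := fun u : TangentAt q => f u) hTm.aemeasurable
            (hfm.comp measurable_subtype_coe).aestronglyMeasurable).symm
      _ = ∫ u : TangentAt q, κ * (f u * w u) := by
          rw [hlaw, integral_withDensity_eq_integral_toReal_smul
            (hwm.const_mul κ).ennreal_ofReal (by simp)]
          refine integral_congr_ae (ae_of_all _ fun u => ?_)
          simp only [ENNReal.toReal_ofReal (hw0 u), smul_eq_mul]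
          ring
      _ = _ := by rw [integral_const_mul, hκ']
  change Tendsto (fun n => ∫ z, f z ∂(P.map _)) atTop (𝓝 (∫ z, f z ∂(P'.map _)))
  rw [hval]
  refine hmain.congr fun n => ?_
  rw [integral_map (hZm n).aemeasurable hfm.aestronglyMeasurable]

theorem theorem4p1 {d : ℕ} (hd : 2 ≤ d)
    {Ω : Type*} [MeasurableSpace Ω] (P : Measure Ω) [IsProbabilityMeasure P]
    (q : UnitSphere d) (ρ : UnitSphere d → ℝ) (X : ℕ → Ω → UnitSphere d)
    (hX : IsIIDSphericalContext hd P q ρ X)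
    (V : Matrix (Fin d) (Fin d) ℝ) (β : ℕ → ℝ)
    (hβ : Tendsto (fun n : ℕ => β n * (n : ℝ) ^ (-alphaExp d)) atTop atTop) :
    -- the limit defining `C(q)` exists and is positive
    (Tendsto (fun t : ℝ => d2qCDF q ρ t * t ^ (-(1 / alphaExp d))) (𝓝[>] 0)
        (𝓝 (localIntensity q ρ)) ∧ 0 < localIntensity q ρ) ∧
    -- convergence in distribution of the rescaled displacement
    (∀ {Ω' : Type*} [MeasurableSpace Ω'] (P' : Measure Ω') [IsProbabilityMeasure P']
        (R : Ω' → ℝ) (Θ : Ω' → TangentSphere q),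
        IsWeibull P' (alphaExp d) R → Measurable Θ → P'.map Θ = tangentUniform q →
        IndepFun R Θ P' →
        TendstoInDistribution
          (fun (n : ℕ) ω => √((localIntensity q ρ * (n : ℝ)) ^ alphaExp d) •
            attentionDisplacement V (β n) q (fun j : Fin n => X j ω))
          atTop
          (fun ω' => Matrix.toEuclideanCLM (𝕜 := ℝ) V
            (√(2 * R ω') • ((Θ ω' : TangentAt q) : EuclideanSpace ℝ (Fin d))))
          (fun _ => P) P') ∧
    -- convergence in probability
    TendstoInMeasure P
      (fun (n : ℕ) ω => attentionDisplacement V (β n) q (fun j : Fin n => X j ω)) atTop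
      (fun _ => 0) ∧
    TendstoInMeasure P
      (fun (n : ℕ) ω => attentionOutput V (β n) q (fun j : Fin n => X j ω)) atTop
      (fun _ => Matrix.toEuclideanCLM (𝕜 := ℝ) V (q : EuclideanSpace ℝ (Fin d))) := by
  have hρ : Continuous ρ := by
    have := finrank_fact_of_two_le hd
    exact ContMDiff.continuous hX.density_C2
  obtain ⟨h, H, h0⟩ := exists_gnomonicModel hd q hX.density_nonneg hX.density_pos hρ
  have : IsProbabilityMeasure (contextLaw ρ) := hX.isProbabilityMeasure
  have hmpos : 0 < Module.finrank ℝ (TangentAt q) := by rw [finrank_tangentAt hd]; omega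
  have : Nontrivial (TangentAt q) := Module.finrank_pos_iff.1 hmpos
  have hα := alphaExp_eq hd q
  set m := Module.finrank ℝ (TangentAt q)
  set C := IsGnomonicModel.intensity h with hCdef
  have hC : 0 < C := IsGnomonicModel.intensity_pos h0
  have hαpos : 0 < alphaExp d := by rw [hα]; positivity
  have hlim : Tendsto (fun t : ℝ => d2qCDF q ρ t * t ^ (-(1 / alphaExp d))) (𝓝[>] 0) (𝓝 C) := by
    rw [hα, one_div_div]
    exact H.tendsto_cdf_mul_rpow
  have hloc : localIntensity q ρ = C := hlim.limUnder_eq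
  rw [hloc]
  refine ⟨⟨hlim, hC⟩, ?_⟩
  -- With `α = 2 / m`, the scale satisfies `s n ^ m = C * n` and `s n ^ 2 = a_n`, so `β n / s n ^ 2`
  -- is `β n * n ^ (-α)` up to the positive constant `C ^ (-α)`.
  set s : ℕ → ℝ := fun n => √((C * n) ^ alphaExp d) with hs_def
  have hsn : ∀ n : ℕ, s n ^ m = C * n := fun n => by
    simp only [hs_def, hα]
    exact sqrt_rpow_alphaExp_pow hmpos (by positivity)
  have hs2 : ∀ n, s n ^ 2 = (C * n) ^ alphaExp d := fun n => Real.sq_sqrt (by positivity)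
  have hs : Tendsto s atTop atTop :=
    Real.tendsto_sqrt_atTop.comp ((tendsto_rpow_atTop hαpos).comp
      (tendsto_natCast_atTop_atTop.const_mul_atTop hC))
  have hβs : Tendsto (fun n => β n / s n ^ 2) atTop atTop := by
    refine (hβ.const_mul_atTop (show 0 < (C ^ alphaExp d)⁻¹ by positivity)).congr fun n => ?_
    rw [hs2, Real.mul_rpow hC.le n.cast_nonneg, Real.rpow_neg n.cast_nonneg, div_eq_mul_inv,
      mul_inv]
    ring
  have hmeas := tendstoInMeasure_attentionShift H h0 hX.measurable hX.indep hX.law hs hsn hβs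
  have hdisp : TendstoInMeasure P
      (fun (n : ℕ) ω => attentionDisplacement V (β n) q (fun j : Fin n => X j ω)) atTop
      (fun _ => 0) := by
    rw [tendstoInMeasure_iff_norm] at hmeas ⊢
    intro ε hε
    set A := Matrix.toEuclideanCLM (𝕜 := ℝ) V
    -- The added `1` keeps the divisor positive when `V = 0`.
    have hA : 0 < ‖A‖ + 1 := by positivity
    refine tendsto_of_tendsto_of_tendsto_of_le_of_le tendsto_const_nhds
      (hmeas (ε / (‖A‖ + 1)) (by positivity)) (fun _ => zero_le) fun n => ?_
    refine measure_mono fun ω hω => ?_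
    simp only [Set.mem_ofPred_eq, sub_zero, attentionDisplacement_eq] at hω ⊢
    rw [div_le_iff₀ hA, mul_comm]
    refine hω.trans ((A.le_opNorm _).trans ?_)
    gcongr
    linarith
  refine ⟨?_, hdisp, ?_⟩
  · intro Ω' _ P' _ R Θ hR hΘm hΘ hind
    rw [hα] at hR
    have h1 := (tendstoInDistribution_attentionShift H h0 hX.measurable hX.indep hX.law hs hsn hβs
      hR hΘm hΘ hind).continuous_comp (Matrix.toEuclideanCLM (𝕜 := ℝ) V).continuous
    have h2 : (fun (n : ℕ) ω => s n • attentionDisplacement V (β n) q (fun j : Fin n => X j ω)) =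
        fun n => Matrix.toEuclideanCLM (𝕜 := ℝ) V ∘ fun ω =>
          s n • attentionShift (β n) q (fun j : Fin n => X j ω) := by
      funext n ω
      rw [attentionDisplacement_eq, Function.comp_apply, map_smul]
    rw [← h2] at h1
    exact h1
  · rw [tendstoInMeasure_iff_norm] at hdisp ⊢
    simpa only [attentionDisplacement, sub_zero] using hdisp
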